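/- Let $\mathsf{ZFC}^-_j$ be the first-order theory in the language $\{\in, j\}$, with $j$ a unary function symbol, whose axioms are: Extensionality, Foundation, Pairing, Union and Infinity; the Separation and Collection schemes for all formulas of the language $\{\in, j\}$ (with parameters); the well-ordering principle (every set is well-orderable); Nontriviality, $\exists x\,(j(x)\neq x)$; and the Elementarity scheme $$\forall x_0\cdots\forall x_{n-1}\,\bigl[\phi(x_0,\dots,x_{n-1})\leftrightarrow\phi(j(x_0),\dots,j(x_{n-1}))\bigr]$$ for all formulas $\phi$ of the language $\{\in\}$. (Powerset is not an axiom.) Say that $j$ is cofinal if for every $a$ there is $b$ such that $a\in j(b)$. Proposition (Hayut). $\mathsf{ZFC}^-_j$ proves that $j$ is not cofinal. Equivalently, by the completeness theorem, in every model of $\mathsf{ZFC}^-_j$ there is an element $a$ such that $a\in j(b)$ holds for no element $b$. -/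

import Mathlib

open FirstOrder FirstOrder.Language

namespace SetTheoryJ

/-! ### The languages `{∈}` and `{∈, j}` -/

/-- The only relation symbol: binary membership. -/
inductive MemRel : ℕ → Type
  | mem : MemRel 2

/-- The only function symbol: the unary symbol `j`. -/
inductive JFun : ℕ → Type
  | j : JFun 1

/-- The language `{∈}` of set theory. -/
def LSet : FirstOrder.Language.{0, 0} where
  Functions := fun _ => Empty
  Relations := MemRel

/-- The language `{∈, j}`. -/
def LSetJ : FirstOrder.Language.{0, 0} where
  Functions := JFun
  Relations := MemRel

/-- The inclusion of the language `{∈}` in the language `{∈, j}`. -/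
def LSet.incl : LSet →ᴸ LSetJ where
  onFunction := fun _ f => Empty.elim f
  onRelation := fun _ R => R

/-- The term `j(t)`. -/
def jTerm {α : Type} (t : LSetJ.Term α) : LSetJ.Term α :=
  Functions.apply₁ (L := LSetJ) JFun.j t

/-- The formula `t ∈ s` for terms `t`, `s`. -/
def memT {α : Type} {n : ℕ} (t s : LSetJ.Term (α ⊕ Fin n)) : LSetJ.BoundedFormula α n :=
  Relations.boundedFormula₂ (L := LSetJ) MemRel.mem t s

/-! ### Abbreviations for formulas

In a formula of type `LSetJ.BoundedFormula α n` the variables bound from outside are numbered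
`0, …, n - 1`, and a further quantifier binds the variable number `n`, that is `Fin.last n`. -/

section Abbreviations

variable {α : Type} {n : ℕ}

/-- `x ∈ y` -/
def memF (x y : Fin n) : LSetJ.BoundedFormula α n :=
  memT (Term.var (Sum.inr x)) (Term.var (Sum.inr y))

/-- `x = y` -/
def eqF (x y : Fin n) : LSetJ.BoundedFormula α n :=
  Term.bdEqual (Term.var (Sum.inr x)) (Term.var (Sum.inr y))

/-- `∀ x ∈ a, φ`, where the bound variable `x` has number `n`. -/
def allIn (a : Fin n) (φ : LSetJ.BoundedFormula α (n + 1)) : LSetJ.BoundedFormula α n :=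
  ∀' (memF (Fin.last n) a.castSucc ⟹ φ)

/-- `∃ x ∈ a, φ`, where the bound variable `x` has number `n`. -/
def exIn (a : Fin n) (φ : LSetJ.BoundedFormula α (n + 1)) : LSetJ.BoundedFormula α n :=
  ∃' (memF (Fin.last n) a.castSucc ⊓ φ)

/-- `x = ∅` -/
def isEmptyF (x : Fin n) : LSetJ.BoundedFormula α n :=
  ∀' ∼(memF (Fin.last n) x.castSucc)

/-- `z = {x, y}` -/
def isUPairF (z x y : Fin n) : LSetJ.BoundedFormula α n :=
  ∀' (memF (Fin.last n) z.castSucc ⇔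
    (eqF (Fin.last n) x.castSucc ⊔ eqF (Fin.last n) y.castSucc))

/-- `p = (x, y) = {{x}, {x, y}}` -/
def isOPairF (p x y : Fin n) : LSetJ.BoundedFormula α n :=
  ∀' (memF (Fin.last n) p.castSucc ⇔
    (isUPairF (Fin.last n) x.castSucc x.castSucc ⊔
      isUPairF (Fin.last n) x.castSucc y.castSucc))

/-- `y = x ∪ {x}` -/
def isSuccF (y x : Fin n) : LSetJ.BoundedFormula α n :=
  ∀' (memF (Fin.last n) y.castSucc ⇔
    (memF (Fin.last n) x.castSucc ⊔ eqF (Fin.last n) x.castSucc))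

/-- `(x, y) ∈ r` -/
def relF (r x y : Fin n) : LSetJ.BoundedFormula α n :=
  exIn r (isOPairF (Fin.last n) x.castSucc y.castSucc)

end Abbreviations

/-- The universal closure `∀ x₀ … ∀ xₙ₋₁, φ` of a formula with free variables `x₀, …, xₙ₋₁`. -/
noncomputable def univClosure {n : ℕ} (φ : LSetJ.Formula (Fin n)) : LSetJ.Sentence :=
  Formula.iAlls (α := Empty) (β := Fin n) (φ.relabel Sum.inr)

/-! ### The axioms of `ZF⁻` -/

/-- `∀ x y, (∀ z, z ∈ x ↔ z ∈ y) → x = y` -/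
def extensionality : LSetJ.Sentence :=
  ∀' ∀' ((∀' (memF (n := 3) 2 0 ⇔ memF 2 1)) ⟹ eqF (n := 2) 0 1)

/-- `∀ x, (∃ y, y ∈ x) → ∃ y ∈ x, ∀ z ∈ y, z ∉ x` -/
def foundation : LSetJ.Sentence :=
  ∀' ((∃' (memF (n := 2) 1 0)) ⟹ exIn (n := 1) 0 (allIn (n := 2) 1 (∼(memF (n := 3) 2 0))))

/-- `∀ x y, ∃ z, z = {x, y}` -/
def pairing : LSetJ.Sentence :=
  ∀' ∀' ∃' (isUPairF (n := 3) 2 0 1)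

/-- `∀ a, ∃ u, ∀ x, x ∈ u ↔ ∃ y ∈ a, x ∈ y` -/
def union : LSetJ.Sentence :=
  ∀' ∃' ∀' (memF (n := 3) 2 1 ⇔ exIn (n := 3) 0 (memF (n := 4) 2 3))

/-- `∃ w, (∃ x ∈ w, x = ∅) ∧ ∀ x ∈ w, ∃ y ∈ w, y = x ∪ {x}` -/
def infinity : LSetJ.Sentence :=
  ∃' (exIn (n := 1) 0 (isEmptyF (n := 2) 1) ⊓
    allIn (n := 1) 0 (exIn (n := 2) 0 (isSuccF (n := 3) 2 1)))

/-- The instance of Separation for a formula `φ(p, x)` in the language `{∈, j}`, with parameters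
`p = p₀, …, pₙ₋₁`: `∀ p, ∀ a, ∃ b, ∀ x, x ∈ b ↔ x ∈ a ∧ φ(p, x)`. -/
noncomputable def separation {n : ℕ} (φ : LSetJ.Formula (Fin n ⊕ Fin 1)) : LSetJ.Sentence :=
  univClosure <|
    ∀' ∃' ∀' (memF (n := 3) 2 1 ⇔
      (memF (n := 3) 2 0 ⊓ BoundedFormula.relabel (n := 3) (Sum.map id ![2]) φ))

/-- The instance of Collection for a formula `φ(p, x, y)` in the language `{∈, j}`, with parameters
`p = p₀, …, pₙ₋₁`: `∀ p, ∀ a, (∀ x ∈ a, ∃ y, φ(p, x, y)) → ∃ b, ∀ x ∈ a, ∃ y ∈ b, φ(p, x, y)`. -/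
noncomputable def collection {n : ℕ} (φ : LSetJ.Formula (Fin n ⊕ Fin 2)) : LSetJ.Sentence :=
  univClosure <|
    ∀' (allIn (n := 1) 0 (∃' (BoundedFormula.relabel (n := 3) (Sum.map id ![1, 2]) φ)) ⟹
      ∃' (allIn (n := 2) 0 (exIn (n := 3) 1
        (BoundedFormula.relabel (n := 4) (Sum.map id ![2, 3]) φ))))

/-! ### The well-ordering principle -/

/-- The relation coded by the set of ordered pairs `r` is a strict well-order of the set `a`:
it is irreflexive, transitive and trichotomous on `a`, and every nonempty `s ⊆ a` has a least
element. Here `a` and `r` are the variables number `0` and `1`. -/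
def wellOrders : LSetJ.BoundedFormula Empty 2 :=
  (allIn (n := 2) 0 (∼(relF (n := 3) 1 2 2)) ⊓
    allIn (n := 2) 0 (allIn (n := 3) 0 (allIn (n := 4) 0
      (relF (n := 5) 1 2 3 ⟹ relF (n := 5) 1 3 4 ⟹ relF (n := 5) 1 2 4)))) ⊓
  (allIn (n := 2) 0 (allIn (n := 3) 0
      (eqF (n := 4) 2 3 ⊔ (relF (n := 4) 1 2 3 ⊔ relF (n := 4) 1 3 2))) ⊓
    ∀' (allIn (n := 3) 2 (memF (n := 4) 3 0) ⟹ (∃' (memF (n := 4) 3 2)) ⟹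
      exIn (n := 3) 2 (allIn (n := 4) 2 (eqF (n := 5) 4 3 ⊔ relF (n := 5) 1 3 4))))

/-- Every set is well-orderable. -/
def wellOrdering : LSetJ.Sentence :=
  ∀' ∃' wellOrders

/-! ### The axioms on `j` -/

/-- `∃ x, j(x) ≠ x` -/
def nontriviality : LSetJ.Sentence :=
  ∃' ∼(Term.bdEqual (n := 1) (jTerm (Term.var (Sum.inr 0))) (Term.var (Sum.inr 0)))

/-- The instance of Elementarity for a formula `φ(x₀, …, xₙ₋₁)` in the language `{∈}`:
`∀ x₀ … ∀ xₙ₋₁, φ(x₀, …, xₙ₋₁) ↔ φ(j(x₀), …, j(xₙ₋₁))`. -/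
noncomputable def elementarity {n : ℕ} (φ : LSet.Formula (Fin n)) : LSetJ.Sentence :=
  univClosure <|
    BoundedFormula.iff (LSet.incl.onFormula φ)
      (BoundedFormula.subst (LSet.incl.onFormula φ) fun i => jTerm (Term.var i))

/-! ### The theories -/

/-- `ZF⁻_j`: the theory `ZF` without Powerset and with Collection in place of Replacement, where
Separation and Collection are for formulas in the language `{∈, j}`, together with the axioms that
`j` is a nontrivial elementary embedding of the universe into itself. -/
def ZFMinusJ : LSetJ.Theory :=
  {extensionality, foundation, pairing, union, infinity} ∪
    (⋃ n : ℕ, Set.range (separation (n := n))) ∪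
    (⋃ n : ℕ, Set.range (collection (n := n))) ∪
    {nontriviality} ∪
    (⋃ n : ℕ, Set.range (elementarity (n := n)))

/-- `ZFC⁻_j`: the theory `ZF⁻_j` with the well-ordering principle. -/
def ZFCMinusJ : LSetJ.Theory :=
  ZFMinusJ ∪ {wellOrdering}

/-- `j` is cofinal: `∀ a, ∃ b, a ∈ j(b)`. -/
def cofinality : LSetJ.Sentence :=
  ∀' ∃' (memT (n := 2) (Term.var (Sum.inr 0)) (jTerm (Term.var (Sum.inr 1))))

end SetTheoryJ

namespace SetTheoryJ

/-! The argument is semantic: in a model, let $j$ be the embedding. Iterating $x \mapsto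
x\cup\bigcup x\cup j(x)\cup x\times x$ through $\omega$ gives a transitive set $D\supseteq\omega$,
closed under pairs, with $j(D)\subseteq D$ and containing a point moved by $j$; hence some $\beta\in
j(D)$ is not in $j''D$ (`exists_closed_set`). There are two cases.

If some set does not inject into $D$, Woodin's proof of Kunen's inconsistency applies
(`inj_of_closed`). A well-order $W$ of type $|D|^+$ carries $|D|$ many disjoint stationary sets of
points of cofinality $\omega$. Collapse $j(W)$ onto an initial segment of $W$ by $G$. The $\beta$-th
set of the image partition contains a point $\alpha$ closed under $j\circ G$, and countable
cofinality forces $\alpha=j(G(\alpha))$. By elementarity the index of $\alpha$ is then in $j''D$, a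
contradiction.

So every set injects into $D$. If $j''D\in j(b)$, take one partial function $F$ that maps every
$x\in b$ of size $|D|$ onto $D$ (`exists_transversal`). Then $j(F)$ maps $j''D$ onto $j(D)$, whereas
$j(F)(j(d))=j(F(d))$ always lies in $j''D$. Thus $a=j''D$ refutes cofinality
(`not_cofinal_of_largest`).

Axiom schemes are used through a predicate `Dfn`, whose instances are found by type class search;
the flag separates formulas usable in Elementarity from those usable in Separation and Collection.
-/

/-- A binary membership relation together with a unary operation. -/
class MemJ (M : Type*) where
  /-- The membership relation. -/
  mem : M → M → Prop
  /-- The unary operation. -/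
  j : M → M

open MemJ (j)

instance {M : Type*} [MemJ M] : Membership M M := ⟨fun a x => MemJ.mem x a⟩

/-! ### Definable predicates on assignments. -/

section Definability

variable {M : Type*} [MemJ M]

/-- The maps `(ℕ → M) → M` given by terms: only variables if `b = false`, and terms in `j` and
constants from `M` if `b = true`. -/
class inductive Tm : Bool → ((ℕ → M) → M) → Prop
  | var (b : Bool) (i : ℕ) : Tm b (fun v => v i)
  | const (a : M) : Tm true (fun _ => a)
  | app (t : (ℕ → M) → M) : Tm true t → Tm true (fun v => j (t v))

/-- The context `v` extended by a new value of the variable number `0`. -/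
def push (x : M) (v : ℕ → M) : ℕ → M
  | 0 => x
  | i + 1 => v i

/-- The predicates on assignments that are definable: by formulas in `{∈}` without parameters if
`b = false`, and by formulas in `{∈, j}` with parameters if `b = true`. -/
class inductive Dfn : Bool → ((ℕ → M) → Prop) → Prop
  | mem {b s t} : Tm b s → Tm b t → Dfn b (fun v => s v ∈ t v)
  | eq {b s t} : Tm b s → Tm b t → Dfn b (fun v => s v = t v)
  | false (b) : Dfn b (fun _ => False)
  | imp {b P Q} : Dfn b P → Dfn b Q → Dfn b (fun v => P v → Q v)
  | all {b} {P : (ℕ → M) → Prop} : Dfn b P → Dfn b (fun v => ∀ x, P (push x v))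

variable {b : Bool}

instance (i : ℕ) : Tm b (fun v : ℕ → M => v i) := Tm.var b i
instance (a : M) : Tm true (fun _ : ℕ → M => a) := Tm.const a
instance (t : (ℕ → M) → M) [h : Tm true t] : Tm true (fun v : ℕ → M => j (t v)) := Tm.app t h

instance Dfn.inst_mem {s t : (ℕ → M) → M} [hs : Tm b s] [ht : Tm b t] :
    Dfn b (fun v => s v ∈ t v) := .mem hs ht
instance Dfn.inst_eq {s t : (ℕ → M) → M} [hs : Tm b s] [ht : Tm b t] :
    Dfn b (fun v => s v = t v) := .eq hs ht
instance Dfn.inst_imp {P Q : (ℕ → M) → Prop} [hP : Dfn b P] [hQ : Dfn b Q] :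
    Dfn b (fun v => P v → Q v) := .imp hP hQ
instance Dfn.inst_not {P : (ℕ → M) → Prop} [hP : Dfn b P] :
    Dfn b (fun v => ¬ P v) := .imp hP (.false b)
instance Dfn.inst_and {P Q : (ℕ → M) → Prop} [hP : Dfn b P] [hQ : Dfn b Q] :
    Dfn b (fun v => P v ∧ Q v) := by
  have : Dfn b (fun v => ¬ (P v → ¬ Q v)) := inferInstance
  convert this using 2
  simp
instance Dfn.inst_or {P Q : (ℕ → M) → Prop} [hP : Dfn b P] [hQ : Dfn b Q] :
    Dfn b (fun v => P v ∨ Q v) := by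
  have : Dfn b (fun v => (¬ P v → Q v)) := inferInstance
  convert this using 2
  tauto
instance Dfn.inst_iff {P Q : (ℕ → M) → Prop} [hP : Dfn b P] [hQ : Dfn b Q] :
    Dfn b (fun v => P v ↔ Q v) := by
  have : Dfn b (fun v => (P v → Q v) ∧ (Q v → P v)) := inferInstance
  convert this using 2
  tauto
-- De Bruijn shift: the bound value has index `0` and the outer context moves up by one; composing
-- with `push` undoes this definitionally.
instance Dfn.inst_all {P : (ℕ → M) → M → Prop}
    [hP : Dfn b (fun v => P (fun i => v (i + 1)) (v 0))] :
    Dfn b (fun v => ∀ x, P v x) := .all hP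
instance Dfn.inst_ex {P : (ℕ → M) → M → Prop}
    [hP : Dfn b (fun v => P (fun i => v (i + 1)) (v 0))] :
    Dfn b (fun v => ∃ x, P v x) := by
  have : Dfn b (fun v => ¬ ∀ x, ¬ P v x) := inferInstance
  convert this using 2
  simp

theorem Tm.subst {t : (ℕ → M) → M} {b' : Bool} (h : Tm b' t) (hb : b' = true → b = true)
    (σ : ℕ → (ℕ → M) → M) (hσ : ∀ i, Tm b (σ i)) : Tm b (fun v => t (fun i => σ i v)) := by
  induction h with
  | var b i => exact hσ i
  | const a => obtain rfl := hb rfl; infer_instance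
  | app t ht ih => obtain rfl := hb rfl; exact Tm.app _ (ih fun _ => rfl)

theorem Dfn.subst {P : (ℕ → M) → Prop} {b' : Bool} (h : Dfn b' P) (hb : b' = true → b = true)
    (σ : ℕ → (ℕ → M) → M) (hσ : ∀ i, Tm b (σ i)) : Dfn b (fun v => P (fun i => σ i v)) := by
  induction h generalizing σ with
  | mem hs ht => exact .mem (hs.subst hb σ hσ) (ht.subst hb σ hσ)
  | eq hs ht => exact .eq (hs.subst hb σ hσ) (ht.subst hb σ hσ)
  | false => exact .false b
  | imp _ _ ih ih' => exact .imp (ih σ hσ) (ih' σ hσ)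
  | @all P _ ih =>
    -- Under the quantifier the substitution is lifted: index `0` is kept and the other terms read
    -- the shifted context.
    have := Dfn.all (ih (fun i v => push (v 0) (fun k => σ k (fun n => v (n + 1))) i) (by
      rintro (_ | i)
      · exact Tm.var b 0
      · exact (hσ i).subst id _ (fun n => Tm.var b (n + 1))))
    convert this using 2 with v
    refine forall_congr' fun x => iff_of_eq (congrArg P (funext ?_))
    rintro (_ | i) <;> rfl

/-- These special cases let a defined notion, once shown definable in plain variables, act as an
atom at arbitrary terms in instance search. -/
theorem Dfn.subst₁ {P : M → Prop} (h : Dfn b (fun v => P (v 0))) (s : (ℕ → M) → M)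
    [hs : Tm b s] : Dfn b (fun v => P (s v)) :=
  h.subst id (fun _ => s) (fun _ => hs)

theorem Dfn.subst₂ {P : M → M → Prop} (h : Dfn b (fun v => P (v 0) (v 1))) (s t : (ℕ → M) → M)
    [hs : Tm b s] [ht : Tm b t] : Dfn b (fun v => P (s v) (t v)) :=
  h.subst id (fun | 0 => s | _ => t) (by rintro (_ | _) <;> assumption)

theorem Dfn.subst₃ {P : M → M → M → Prop} (h : Dfn b (fun v => P (v 0) (v 1) (v 2)))
    (s t u : (ℕ → M) → M) [hs : Tm b s] [ht : Tm b t] [hu : Tm b u] :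
    Dfn b (fun v => P (s v) (t v) (u v)) :=
  h.subst id (fun | 0 => s | 1 => t | _ => u) (by rintro (_ | _ | _) <;> assumption)

theorem Dfn.subst₅ {P : M → M → M → M → M → Prop}
    (h : Dfn b (fun v => P (v 0) (v 1) (v 2) (v 3) (v 4)))
    (s t u w x : (ℕ → M) → M) [hs : Tm b s] [ht : Tm b t] [hu : Tm b u] [hw : Tm b w]
    [hx : Tm b x] : Dfn b (fun v => P (s v) (t v) (u v) (w v) (x v)) :=
  h.subst id (fun | 0 => s | 1 => t | 2 => u | 3 => w | _ => x)
    (by rintro (_ | _ | _ | _ | _) <;> assumption)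

/-- `z = {x, y}` -/
def IsUP (z x y : M) : Prop := ∀ w, w ∈ z ↔ w = x ∨ w = y

/-- `p = (x, y)` -/
def IsOP (p x y : M) : Prop := ∀ w, w ∈ p ↔ IsUP w x x ∨ IsUP w x y

/-- `(x, y) ∈ r` -/
def App (r x y : M) : Prop := ∃ p ∈ r, IsOP p x y

instance {s t u : (ℕ → M) → M} [Tm b s] [Tm b t] [Tm b u] :
    Dfn b (fun v => IsUP (s v) (t v) (u v)) :=
  Dfn.subst₃ (by unfold IsUP; infer_instance) s t u

instance {s t u : (ℕ → M) → M} [Tm b s] [Tm b t] [Tm b u] :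
    Dfn b (fun v => IsOP (s v) (t v) (u v)) :=
  Dfn.subst₃ (by unfold IsOP; infer_instance) s t u

instance {s t u : (ℕ → M) → M} [Tm b s] [Tm b t] [Tm b u] :
    Dfn b (fun v => App (s v) (t v) (u v)) :=
  Dfn.subst₃ (by unfold App; infer_instance) s t u

end Definability

/-- `r` codes a strict well-order of `a`. -/
def WO {M : Type*} [MemJ M] (a r : M) : Prop :=
  (∀ x ∈ a, ¬ App r x x) ∧
  (∀ x ∈ a, ∀ y ∈ a, ∀ z ∈ a, App r x y → App r y z → App r x z) ∧
  (∀ x ∈ a, ∀ y ∈ a, x = y ∨ App r x y ∨ App r y x) ∧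
  ∀ s : M, (∀ x ∈ s, x ∈ a) → (∃ x, x ∈ s) → ∃ x ∈ s, ∀ y ∈ s, y = x ∨ App r x y

instance {M : Type*} [MemJ M] {b : Bool} {s t : (ℕ → M) → M} [Tm b s] [Tm b t] :
    Dfn b (fun v => WO (s v) (t v)) :=
  Dfn.subst₂ (by unfold WO; infer_instance) s t

/-- The models of `ZFC⁻_j`, with the schemes stated for definable predicates. -/
class ZFCj (M : Type*) extends MemJ M where
  ext : ∀ x y : M, (∀ z, z ∈ x ↔ z ∈ y) → x = y
  found : ∀ x : M, (∃ y, y ∈ x) → ∃ y ∈ x, ∀ z ∈ y, z ∉ x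
  pairing : ∀ x y : M, ∃ z, IsUP z x y
  union : ∀ a : M, ∃ u : M, ∀ x, x ∈ u ↔ ∃ y ∈ a, x ∈ y
  infinity : ∃ w : M, (∃ x ∈ w, ∀ z, z ∉ x) ∧ ∀ x ∈ w, ∃ y ∈ w, ∀ z, z ∈ y ↔ z ∈ x ∨ z = x
  sep : ∀ (P : M → Prop) [Dfn true (fun v => P (v 0))] (a : M), ∃ b : M, ∀ x, x ∈ b ↔ x ∈ a ∧ P x
  coll : ∀ (P : M → M → Prop) [Dfn true (fun v => P (v 0) (v 1))] (a : M),
    (∀ x ∈ a, ∃ y, P x y) → ∃ b : M, ∀ x ∈ a, ∃ y ∈ b, P x y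
  wo : ∀ a : M, ∃ r, WO a r
  nontriv : ∃ x : M, j x ≠ x
  -- Indices are read modulo `n + 1`, so that a finite tuple gives an assignment of all variables.
  elem : ∀ (n : ℕ) (P : (ℕ → M) → Prop) [Dfn false P] (v : Fin (n + 1) → M),
    P (fun i => v (Fin.ofNat (n + 1) i)) ↔ P (fun i => j (v (Fin.ofNat (n + 1) i)))

/-! ### From definable predicates to first-order formulas. -/

section Realize

variable {M : Type*} [LSetJ.Structure M]

/-- The membership relation and the map `j` of a structure for `{∈, j}`. -/
instance memJOfStructure : MemJ M where
  mem x y := Structure.RelMap (L := LSetJ) MemRel.mem ![x, y]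
  j x := Structure.funMap (L := LSetJ) JFun.j ![x]

/-- Stated for a general language and constants `A` in order to serve both $\{\in,j\}$ with `A = M`
and $\{\in\}$ with `A = Empty`. -/
theorem Dfn.exists_formula {L : FirstOrder.Language.{0, 0}} [L.Structure M] {A : Type*} (e : A → M)
    (R : L.Relations 2) (hR : ∀ x y : M, Structure.RelMap R ![x, y] ↔ x ∈ y) {b : Bool}
    (hT : ∀ t : (ℕ → M) → M, Tm b t →
      ∃ τ : L.Term (A ⊕ ℕ), ∀ v, τ.realize (Sum.elim e v) = t v)
    {P : (ℕ → M) → Prop} (hP : Dfn b P) :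
    ∃ φ : L.Formula (A ⊕ ℕ), ∀ v, φ.Realize (Sum.elim e v) ↔ P v := by
  induction hP with
  | @mem s t hs ht =>
    obtain ⟨σ, hσ⟩ := hT _ hs
    obtain ⟨τ, hτ⟩ := hT _ ht
    exact ⟨R.formula₂ σ τ, fun v => by rw [Formula.realize_rel₂, hσ, hτ, hR]⟩
  | @eq s t hs ht =>
    obtain ⟨σ, hσ⟩ := hT _ hs
    obtain ⟨τ, hτ⟩ := hT _ ht
    exact ⟨σ.equal τ, fun v => by rw [Formula.realize_equal, hσ, hτ]⟩
  | false => exact ⟨⊥, fun v => by simp⟩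
  | imp _ _ ih ih' =>
    obtain ⟨φ, hφ⟩ := ih
    obtain ⟨ψ, hψ⟩ := ih'
    exact ⟨φ.imp ψ, fun v => by rw [Formula.realize_imp, hφ, hψ]⟩
  | all _ ih =>
    obtain ⟨φ, hφ⟩ := ih
    let g : A ⊕ ℕ → (A ⊕ ℕ) ⊕ Fin 1
      | .inl a => .inl (.inl a)
      | .inr 0 => .inr 0
      | .inr (i + 1) => .inl (.inr i)
    refine ⟨(BoundedFormula.relabel (n := 1) g φ : L.BoundedFormula _ (0 + 1)).all, fun v => ?_⟩
    refine forall_congr' fun x => ?_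
    refine BoundedFormula.realize_relabel.trans ?_
    rw [← hφ, Formula.Realize, iff_iff_eq]
    congr 1
    · funext i
      rcases i with a | _ | i <;> rfl
    · exact Subsingleton.elim _ _

theorem Tm.exists_termJ (t : (ℕ → M) → M) (ht : Tm true t) :
    ∃ τ : LSetJ.Term (M ⊕ ℕ), ∀ v, τ.realize (Sum.elim id v) = t v := by
  generalize hb : true = b at ht
  induction ht with
  | var b i => exact ⟨.var (.inr i), fun v => rfl⟩
  | const a => exact ⟨.var (.inl a), fun v => rfl⟩
  | app t _ ih =>
    obtain ⟨τ, hτ⟩ := ih rfl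
    refine ⟨Functions.apply₁ (L := LSetJ) JFun.j τ, fun v => ?_⟩
    exact (Term.realize_functions_apply₁ (L := LSetJ)).trans (by rw [hτ]; rfl)

/-- The reduct to the language `{∈}`. -/
instance reduct : LSet.Structure M := LSet.incl.reduct M

instance : LSet.incl.IsExpansionOn M := LSet.incl.isExpansionOn_reduct M

theorem Tm.exists_term (t : (ℕ → M) → M) (ht : Tm false t) :
    ∃ τ : LSet.Term (Empty ⊕ ℕ), ∀ v, τ.realize (Sum.elim Empty.elim v) = t v := by
  generalize hb : false = b at ht
  cases ht with
  | var b i => exact ⟨.var (.inr i), fun v => rfl⟩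
  | const a => cases hb
  | app t _ => cases hb

/-- A formula has finitely many free variables, so only finitely many constants from `M` matter;
they become the parameter tuple of the schemes. -/
theorem exists_params [Nonempty M] (φ : LSetJ.Formula (M ⊕ ℕ)) :
    ∃ (n : ℕ) (p : Fin n → M) (ψ : LSetJ.Formula (Fin n ⊕ ℕ)),
      ∀ v, ψ.Realize (Sum.elim p v) ↔ φ.Realize (Sum.elim id v) := by
  classical
  let e := φ.freeVarFinset.equivFin
  -- The enumeration covers all free variables; the slots of those in `ℕ` get an arbitrary value
  -- that is never read.
  refine ⟨_, fun k => (e.symm k : M ⊕ ℕ).elim id fun _ => Classical.arbitrary M,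
    φ.restrictFreeVar fun x => (x : M ⊕ ℕ).elim (fun _ => .inl (e x)) .inr, fun v => ?_⟩
  refine BoundedFormula.realize_restrictFreeVar _ ?_
  rintro ⟨a | i, h⟩
  · simp
  · rfl

end Realize

/-! ### Models of the theory satisfy the semantic axioms. -/

section Models

variable {M : Type} [LSetJ.Structure M] {α : Type} {n : ℕ} {v : α → M} {xs : Fin n → M}

@[simp] theorem realize_memT (t s : LSetJ.Term (α ⊕ Fin n)) :
    (memT t s).Realize v xs ↔ t.realize (Sum.elim v xs) ∈ s.realize (Sum.elim v xs) :=
  BoundedFormula.realize_rel₂ (L := LSetJ)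

@[simp] theorem realize_jTerm {β : Type} {w : β → M} (t : LSetJ.Term β) :
    (jTerm t).realize w = j (t.realize w) :=
  Term.realize_functions_apply₁ (L := LSetJ)

@[simp] theorem realize_memF (x y : Fin n) :
    (memF x y : LSetJ.BoundedFormula α n).Realize v xs ↔ xs x ∈ xs y :=
  realize_memT _ _

@[simp] theorem realize_eqF (x y : Fin n) :
    (eqF x y : LSetJ.BoundedFormula α n).Realize v xs ↔ xs x = xs y := by
  simp [eqF]

@[simp] theorem realize_allIn (a : Fin n) (φ : LSetJ.BoundedFormula α (n + 1)) :
    (allIn a φ).Realize v xs ↔ ∀ x ∈ xs a, φ.Realize v (Fin.snoc xs x) := by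
  simp [allIn]

@[simp] theorem realize_exIn (a : Fin n) (φ : LSetJ.BoundedFormula α (n + 1)) :
    (exIn a φ).Realize v xs ↔ ∃ x ∈ xs a, φ.Realize v (Fin.snoc xs x) := by
  simp [exIn]

@[simp] theorem realize_isEmptyF (x : Fin n) :
    (isEmptyF x : LSetJ.BoundedFormula α n).Realize v xs ↔ ∀ z, z ∉ xs x := by
  simp [isEmptyF]

@[simp] theorem realize_isUPairF (z x y : Fin n) :
    (isUPairF z x y : LSetJ.BoundedFormula α n).Realize v xs ↔ IsUP (xs z) (xs x) (xs y) := by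
  simp [isUPairF, IsUP]

@[simp] theorem realize_isOPairF (z x y : Fin n) :
    (isOPairF z x y : LSetJ.BoundedFormula α n).Realize v xs ↔ IsOP (xs z) (xs x) (xs y) := by
  simp [isOPairF, IsOP]

@[simp] theorem realize_isSuccF (y x : Fin n) :
    (isSuccF y x : LSetJ.BoundedFormula α n).Realize v xs ↔
      ∀ z, z ∈ xs y ↔ z ∈ xs x ∨ z = xs x := by
  simp [isSuccF]

@[simp] theorem realize_relF (r x y : Fin n) :
    (relF r x y : LSetJ.BoundedFormula α n).Realize v xs ↔ App (xs r) (xs x) (xs y) := by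
  simp [relF, App]

theorem realize_univClosure {n : ℕ} (φ : LSetJ.Formula (Fin n)) :
    M ⊨ univClosure φ ↔ ∀ p : Fin n → M, φ.Realize p := by
  rw [univClosure, Sentence.Realize, Formula.realize_iAlls]
  refine forall_congr' fun p => ?_
  rw [Formula.realize_relabel]
  rfl

theorem realize_wellOrdering (h : M ⊨ wellOrdering) (a : M) : ∃ r, WO a r := by
  simp only [wellOrdering, wellOrders, Sentence.Realize, Formula.Realize,
    BoundedFormula.realize_all, BoundedFormula.realize_ex, BoundedFormula.realize_inf,
    BoundedFormula.realize_imp, BoundedFormula.realize_sup, BoundedFormula.realize_not, realize_allIn, realize_exIn,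
    realize_memF, realize_eqF, realize_relF] at h
  obtain ⟨r, ⟨h1, h2⟩, h3, h4⟩ := h a
  exact ⟨r, h1, h2, h3, h4⟩

theorem realize_separation (h : ∀ n (φ : LSetJ.Formula (Fin n ⊕ Fin 1)), M ⊨ separation φ)
    (P : M → Prop) [hP : Dfn true (fun v => P (v 0))] (a : M) :
    ∃ b : M, ∀ x, x ∈ b ↔ x ∈ a ∧ P x := by
  have : Nonempty M := ⟨a⟩
  obtain ⟨φ, hφ⟩ := hP.exists_formula (L := LSetJ) id MemRel.mem (fun _ _ => Iff.rfl)
    Tm.exists_termJ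
  obtain ⟨n, p, ψ, hψ⟩ := exists_params φ
  have := (realize_univClosure _).1 (h n (ψ.relabel (Sum.map id fun _ => 0))) p
  simp only [Formula.Realize, BoundedFormula.realize_all, BoundedFormula.realize_ex,
    BoundedFormula.realize_iff, BoundedFormula.realize_inf, realize_memF] at this
  obtain ⟨b, hb⟩ := this a
  refine ⟨b, fun x => (hb x).trans (and_congr Iff.rfl ?_)⟩
  refine BoundedFormula.realize_relabel.trans ?_
  rw [← hφ (fun _ => x), ← hψ]
  refine Iff.trans ?_ (Formula.realize_relabel (L := LSetJ) (φ := ψ) (v := Sum.elim p ![x])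
    (g := Sum.map id fun _ => 0)
    |>.trans ?_)
  · rw [Formula.Realize, iff_iff_eq]
    congr 1
    · funext i
      rcases i with i | i
      · rfl
      · obtain rfl := Subsingleton.elim i 0
        rfl
    · exact Subsingleton.elim _ _
  · rw [iff_iff_eq]
    congr 1
    funext i
    rcases i with i | i <;> rfl

theorem realize_collection (h : ∀ n (φ : LSetJ.Formula (Fin n ⊕ Fin 2)), M ⊨ collection φ)
    (P : M → M → Prop) [hP : Dfn true (fun v => P (v 0) (v 1))] (a : M)
    (ha : ∀ x ∈ a, ∃ y, P x y) : ∃ b : M, ∀ x ∈ a, ∃ y ∈ b, P x y := by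
  have : Nonempty M := ⟨a⟩
  obtain ⟨φ, hφ⟩ := hP.exists_formula (L := LSetJ) id MemRel.mem (fun _ _ => Iff.rfl)
    Tm.exists_termJ
  obtain ⟨n, p, ψ, hψ⟩ := exists_params φ
  let g : ℕ → Fin 2 := fun i => if i = 0 then 0 else 1
  have key : ∀ x y : M, (ψ.relabel (Sum.map id g)).Realize (Sum.elim p ![x, y]) ↔ P x y := by
    intro x y
    rw [Formula.realize_relabel]
    refine Iff.trans ?_ ((hψ fun i => if i = 0 then x else y).trans (hφ _))
    rw [iff_iff_eq]
    congr 1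
    funext i
    rcases i with i | _ | i <;> rfl
  have := (realize_univClosure _).1 (h n (ψ.relabel (Sum.map id g))) p
  simp only [Formula.Realize, BoundedFormula.realize_all, BoundedFormula.realize_ex,
    BoundedFormula.realize_imp, realize_allIn, realize_exIn] at this
  obtain ⟨b, hb⟩ := this a fun x hx => by
    obtain ⟨y, hy⟩ := ha x hx
    refine ⟨y, BoundedFormula.realize_relabel.2 ?_⟩
    rw [← key, Formula.Realize] at hy
    convert hy using 1
    funext i
    rcases i with i | i
    · rfl
    · fin_cases i <;> rfl
  refine ⟨b, fun x hx => ?_⟩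
  obtain ⟨y, hyb, hy⟩ := hb x hx
  refine ⟨y, hyb, (key x y).1 ?_⟩
  rw [BoundedFormula.realize_relabel] at hy
  rw [Formula.Realize]
  convert hy using 1
  funext i
  rcases i with i | i
  · rfl
  · fin_cases i <;> rfl

theorem realize_elementarity (h : ∀ n (φ : LSet.Formula (Fin n)), M ⊨ elementarity φ)
    (n : ℕ) (P : (ℕ → M) → Prop) [hP : Dfn false P] (v : Fin (n + 1) → M) :
    P (fun i => v (Fin.ofNat (n + 1) i)) ↔ P (fun i => j (v (Fin.ofNat (n + 1) i))) := by
  obtain ⟨φ, hφ⟩ := hP.exists_formula (L := LSet) (A := Empty) Empty.elim MemRel.mem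
    (fun _ _ => Iff.rfl) Tm.exists_term
  let g : Empty ⊕ ℕ → Fin (n + 1) := Sum.elim Empty.elim (Fin.ofNat (n + 1))
  have key : ∀ v : Fin (n + 1) → M, (LSet.incl.onFormula (φ.relabel g)).Realize v ↔
      P (fun i => v (Fin.ofNat (n + 1) i)) := by
    intro v
    rw [LHom.realize_onFormula, Formula.realize_relabel, ← hφ, iff_iff_eq]
    congr 1
    funext i
    rcases i with i | i
    · exact i.elim
    · rfl
  have := (realize_univClosure _).1 (h _ (φ.relabel g)) v
  rw [Formula.Realize, BoundedFormula.realize_iff, BoundedFormula.realize_subst] at this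
  refine (key v).symm.trans (this.trans ?_)
  refine Iff.trans ?_ (key fun i => j (v i))
  simp [Formula.Realize]

/-- A model of `ZFC⁻_j` satisfies the schemes for definable predicates. -/
abbrev zfcjOfModel (h : M ⊨ ZFCMinusJ) : ZFCj M where
  toMemJ := memJOfStructure
  ext := by
    have := h.realize_of_mem extensionality (by simp [ZFCMinusJ, ZFMinusJ])
    simpa [extensionality, Sentence.Realize, Formula.Realize, Fin.snoc] using this
  found := by
    have := h.realize_of_mem foundation (by simp [ZFCMinusJ, ZFMinusJ])
    simpa [foundation, Sentence.Realize, Formula.Realize, Fin.snoc] using this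
  pairing := by
    have := h.realize_of_mem pairing (by simp [ZFCMinusJ, ZFMinusJ])
    simpa [pairing, Sentence.Realize, Formula.Realize, Fin.snoc] using this
  union := by
    have := h.realize_of_mem union (by simp [ZFCMinusJ, ZFMinusJ])
    simpa [union, Sentence.Realize, Formula.Realize, Fin.snoc] using this
  infinity := by
    have := h.realize_of_mem infinity (by simp [ZFCMinusJ, ZFMinusJ])
    simpa [infinity, Sentence.Realize, Formula.Realize, Fin.snoc] using this
  sep P _ a :=
    realize_separation (fun n φ => h.realize_of_mem _
      (.inl (.inl (.inl (.inl (.inr (Set.mem_iUnion.2 ⟨n, φ, rfl⟩))))))) P a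
  coll P _ a :=
    realize_collection (fun n φ => h.realize_of_mem _
      (.inl (.inl (.inl (.inr (Set.mem_iUnion.2 ⟨n, φ, rfl⟩)))))) P a
  wo := realize_wellOrdering (h.realize_of_mem _ (by simp [ZFCMinusJ]))
  nontriv := by
    have := h.realize_of_mem nontriviality (by simp [ZFCMinusJ, ZFMinusJ])
    simpa [nontriviality, Sentence.Realize, Formula.Realize, Fin.snoc] using this
  elem :=
    realize_elementarity (fun n φ => h.realize_of_mem _
      (.inl (.inr (Set.mem_iUnion.2 ⟨n, φ, rfl⟩))))

theorem models_not_cofinality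
    (H : ∀ (M : Type) [ZFCj M], ¬ ∀ a : M, ∃ b : M, a ∈ j b) : ZFCMinusJ ⊨ᵇ ∼cofinality := by
  refine Theory.models_sentence_iff.2 fun M => ?_
  have := @H M (zfcjOfModel M.is_model)
  simpa [cofinality, Sentence.Realize, Formula.Realize, Fin.snoc] using this

end Models

/-! ### Elementarity, pairs, Replacement and Choice. -/

section Basic

variable {M : Type*} [ZFCj M] {b : Bool}

theorem elem₁ (P : M → Prop) [Dfn false (fun v => P (v 0))] (x : M) : P x ↔ P (j x) :=
  ZFCj.elem 0 (fun v => P (v 0)) ![x]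

theorem elem₂ (P : M → M → Prop) [Dfn false (fun v => P (v 0) (v 1))] (x y : M) :
    P x y ↔ P (j x) (j y) :=
  ZFCj.elem 1 (fun v => P (v 0) (v 1)) ![x, y]

theorem elem₃ (P : M → M → M → Prop) [Dfn false (fun v => P (v 0) (v 1) (v 2))] (x y z : M) :
    P x y z ↔ P (j x) (j y) (j z) :=
  ZFCj.elem 2 (fun v => P (v 0) (v 1) (v 2)) ![x, y, z]

theorem elem₅ (P : M → M → M → M → M → Prop)
    [Dfn false (fun v => P (v 0) (v 1) (v 2) (v 3) (v 4))]
    (x y z w u : M) : P x y z w u ↔ P (j x) (j y) (j z) (j w) (j u) :=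
  ZFCj.elem 4 (fun v => P (v 0) (v 1) (v 2) (v 3) (v 4)) ![x, y, z, w, u]

theorem j_mem_iff {x y : M} : j x ∈ j y ↔ x ∈ y := (elem₂ (fun x y => x ∈ y) x y).symm

theorem j_inj {x y : M} : j x = j y ↔ x = y := (elem₂ (fun x y => x = y) x y).symm

theorem set_ext {x y : M} (h : ∀ z, z ∈ x ↔ z ∈ y) : x = y := ZFCj.ext x y h

theorem not_mem_self (x : M) : x ∉ x := by
  obtain ⟨s, hs⟩ := ZFCj.pairing x x
  obtain ⟨y, hy, h⟩ := ZFCj.found s ⟨x, (hs x).2 (.inl rfl)⟩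
  obtain rfl : y = x := by simpa using (hs y).1 hy
  exact fun hx => h y hx hy

theorem isUP_unique {z z' x y : M} (h : IsUP z x y) (h' : IsUP z' x y) : z = z' :=
  set_ext fun w => (h w).trans (h' w).symm

theorem isOP_unique {z z' x y : M} (h : IsOP z x y) (h' : IsOP z' x y) : z = z' :=
  set_ext fun w => (h w).trans (h' w).symm

theorem exists_isOP (x y : M) : ∃ p, IsOP p x y := by
  obtain ⟨s, hs⟩ := ZFCj.pairing x x
  obtain ⟨t, ht⟩ := ZFCj.pairing x y
  obtain ⟨p, hp⟩ := ZFCj.pairing s t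
  refine ⟨p, fun w => (hp w).trans (or_congr ⟨?_, ?_⟩ ⟨?_, ?_⟩)⟩
  · rintro rfl; exact hs
  · exact fun h => isUP_unique h hs
  · rintro rfl; exact ht
  · exact fun h => isUP_unique h ht

theorem isOP_inj {p x y x' y' : M} (h : IsOP p x y) (h' : IsOP p x' y') : x = x' ∧ y = y' := by
  have key : ∀ {p x y x' y' : M}, IsOP p x y → IsOP p x' y' → x = x' ∧ (y = y' ∨ y = x) := by
    intro p x y x' y' h h'
    obtain ⟨s, hs⟩ := ZFCj.pairing x x
    obtain ⟨t, ht⟩ := ZFCj.pairing x y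
    have h1 := (h' s).1 ((h s).2 (.inl hs))
    have h2 := (h' t).1 ((h t).2 (.inr ht))
    unfold IsUP at *
    have hx : x = x' := by
      rcases h1 with h1 | h1
      · have := (hs x').1 ((h1 x').2 (.inl rfl)); tauto
      · have := (hs x').1 ((h1 x').2 (.inl rfl)); tauto
    refine ⟨hx, ?_⟩
    subst hx
    rcases h2 with h2 | h2
    · have := (h2 y).1 ((ht y).2 (.inr rfl)); tauto
    · have := (h2 y).1 ((ht y).2 (.inr rfl)); tauto
  obtain ⟨rfl, h1⟩ := key h h'
  obtain ⟨-, h2⟩ := key h' h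
  refine ⟨rfl, ?_⟩
  rcases h1 with h1 | h1
  · exact h1
  · rcases h2 with h2 | h2 <;> simp_all

/-- Powerset is replaced by Collection, used twice: a set covering the pairs with first entry `x`,
then a set of such sets for all `x`. -/
theorem exists_prod (A B : M) : ∃ c : M, ∀ p, p ∈ c ↔ ∃ x ∈ A, ∃ y ∈ B, IsOP p x y := by
  have h1 : ∀ x ∈ A, ∃ c : M, ∀ y ∈ B, ∃ p ∈ c, IsOP p x y := fun x _ =>
    ZFCj.coll (fun y p => IsOP p x y) B fun y _ => exists_isOP x y
  obtain ⟨c, hc⟩ := ZFCj.coll _ A h1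
  obtain ⟨u, hu⟩ := ZFCj.union c
  obtain ⟨d, hd⟩ := ZFCj.sep (fun p => ∃ x ∈ A, ∃ y ∈ B, IsOP p x y) u
  refine ⟨d, fun p => (hd p).trans ⟨And.right, fun h => ⟨?_, h⟩⟩⟩
  obtain ⟨x, hx, y, hy, hp⟩ := h
  obtain ⟨e, he, h⟩ := hc x hx
  obtain ⟨q, hq, hq'⟩ := h y hy
  exact (hu p).2 ⟨e, he, isOP_unique hp hq' ▸ hq⟩

theorem exists_rel (A B : M) (P : M → M → Prop) [Dfn true (fun v => P (v 0) (v 1))] :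
    ∃ r : M, ∀ x y, App r x y ↔ x ∈ A ∧ y ∈ B ∧ P x y := by
  -- As a local instance this makes formulas built from `P` recognisably definable.
  have dP : ∀ (s t : (ℕ → M) → M) [Tm true s] [Tm true t], Dfn true (fun v => P (s v) (t v)) :=
    Dfn.subst₂ inferInstance
  obtain ⟨c, hc⟩ := exists_prod A B
  obtain ⟨r, hr⟩ := ZFCj.sep (fun p => ∃ x y, IsOP p x y ∧ P x y) c
  refine ⟨r, fun x y => ⟨?_, ?_⟩⟩
  · rintro ⟨p, hp, hxy⟩
    obtain ⟨hpc, x', y', hxy', hP⟩ := (hr p).1 hp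
    obtain ⟨rfl, rfl⟩ := isOP_inj hxy hxy'
    obtain ⟨x', hx, y', hy, hxy'⟩ := (hc p).1 hpc
    obtain ⟨rfl, rfl⟩ := isOP_inj hxy hxy'
    exact ⟨hx, hy, hP⟩
  · rintro ⟨hx, hy, hP⟩
    obtain ⟨p, hp⟩ := exists_isOP x y
    exact ⟨p, (hr p).2 ⟨(hc p).2 ⟨x, hx, y, hy, hp⟩, x, y, hp, hP⟩, hp⟩

/-- Replacement for partial class functions: the graph is a set. -/
theorem exists_graph (A : M) (P : M → M → Prop) [Dfn true (fun v => P (v 0) (v 1))]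
    (hP : ∀ x ∈ A, ∀ y y', P x y → P x y' → y = y') :
    ∃ r : M, ∀ x y, App r x y ↔ x ∈ A ∧ P x y := by
  have dP : ∀ (s t : (ℕ → M) → M) [Tm true s] [Tm true t], Dfn true (fun v => P (s v) (t v)) :=
    Dfn.subst₂ inferInstance
  -- Collection needs a total relation, hence the restriction to the domain of `P`.
  obtain ⟨A', hA'⟩ := ZFCj.sep (fun x => ∃ y, P x y) A
  obtain ⟨B, hB⟩ := ZFCj.coll P A' fun x hx => ((hA' x).1 hx).2
  obtain ⟨r, hr⟩ := exists_rel A B P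
  refine ⟨r, fun x y => (hr x y).trans ⟨fun h => ⟨h.1, h.2.2⟩, fun h => ⟨h.1, ?_, h.2⟩⟩⟩
  obtain ⟨z, hz, hz'⟩ := hB x ((hA' x).2 ⟨h.1, y, h.2⟩)
  exact hP x h.1 _ _ hz' h.2 ▸ hz

theorem exists_image (A : M) (P : M → M → Prop) [Dfn true (fun v => P (v 0) (v 1))]
    (hP : ∀ x ∈ A, ∀ y y', P x y → P x y' → y = y') :
    ∃ B : M, ∀ y, y ∈ B ↔ ∃ x ∈ A, P x y := by
  have dP : ∀ (s t : (ℕ → M) → M) [Tm true s] [Tm true t], Dfn true (fun v => P (s v) (t v)) :=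
    Dfn.subst₂ inferInstance
  obtain ⟨A', hA'⟩ := ZFCj.sep (fun x => ∃ y, P x y) A
  obtain ⟨B, hB⟩ := ZFCj.coll P A' fun x hx => ((hA' x).1 hx).2
  obtain ⟨C, hC⟩ := ZFCj.sep (fun y => ∃ x ∈ A, P x y) B
  refine ⟨C, fun y => (hC y).trans ⟨And.right, fun h => ⟨?_, h⟩⟩⟩
  obtain ⟨x, hx, h⟩ := h
  obtain ⟨z, hz, hz'⟩ := hB x ((hA' x).2 ⟨hx, y, h⟩)
  exact hP x hx _ _ hz' h ▸ hz

theorem WO.exists_min {A r : M} (h : WO A r) (P : M → Prop) [Dfn true (fun v => P (v 0))]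
    {x : M} (hx : x ∈ A) (hP : P x) : ∃ x ∈ A, P x ∧ ∀ y ∈ A, App r y x → ¬ P y := by
  obtain ⟨s, hs⟩ := ZFCj.sep P A
  obtain ⟨h1, h2, h3, h4⟩ := h
  obtain ⟨m, hm, h⟩ := h4 s (fun x hx => ((hs x).1 hx).1) ⟨x, (hs x).2 ⟨hx, hP⟩⟩
  obtain ⟨hmA, hmP⟩ := (hs m).1 hm
  refine ⟨m, hmA, hmP, fun y hy hym hPy => ?_⟩
  rcases h y ((hs y).2 ⟨hy, hPy⟩) with rfl | h
  · exact h1 _ hy hym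
  · exact h1 _ hy (h2 _ hy _ hmA _ hy hym h)

theorem WO.irrefl {A r x : M} (h : WO A r) (hx : x ∈ A) : ¬ App r x x := h.1 x hx

theorem WO.trans {A r x y z : M} (h : WO A r) (hx : x ∈ A) (hy : y ∈ A) (hz : z ∈ A)
    (hxy : App r x y) (hyz : App r y z) : App r x z := h.2.1 x hx y hy z hz hxy hyz

theorem WO.tri {A r x y : M} (h : WO A r) (hx : x ∈ A) (hy : y ∈ A) :
    x = y ∨ App r x y ∨ App r y x := h.2.2.1 x hx y hy

theorem WO.asymm {A r x y : M} (h : WO A r) (hx : x ∈ A) (hy : y ∈ A) (hxy : App r x y) :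
    ¬ App r y x := fun hyx => h.irrefl hx (h.trans hx hy hx hxy hyx)

theorem WO.mono {A B r : M} (h : WO A r) (hB : ∀ x ∈ B, x ∈ A) : WO B r :=
  ⟨fun x hx => h.1 x (hB x hx),
    fun x hx y hy z hz => h.2.1 x (hB x hx) y (hB y hy) z (hB z hz),
    fun x hx y hy => h.2.2.1 x (hB x hx) y (hB y hy),
    fun s hs => h.2.2.2 s fun x hx => hB x (hs x hx)⟩

/-- Choice for class relations. -/
theorem exists_choice (A : M) (P : M → M → Prop) [Dfn true (fun v => P (v 0) (v 1))]
    (hP : ∀ x ∈ A, ∃ y, P x y) :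
    ∃ f : M, (∀ x ∈ A, ∃ y, App f x y) ∧ (∀ x y, App f x y → x ∈ A ∧ P x y) ∧
      ∀ x y y', App f x y → App f x y' → y = y' := by
  have dP : ∀ (s t : (ℕ → M) → M) [Tm true s] [Tm true t], Dfn true (fun v => P (s v) (t v)) :=
    Dfn.subst₂ inferInstance
  obtain ⟨B, hB⟩ := ZFCj.coll P A hP
  obtain ⟨r, hr⟩ := ZFCj.wo B
  -- Choose the least suitable element of the collecting set.
  obtain ⟨f, hf⟩ := exists_rel A B (fun x y => P x y ∧ ∀ z ∈ B, App r z y → ¬ P x z)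
  refine ⟨f, fun x hx => ?_, fun x y h => ?_, fun x y y' h h' => ?_⟩
  · obtain ⟨y, hy, hxy⟩ := hB x hx
    obtain ⟨y, hy, hxy, hmin⟩ := hr.exists_min (fun y => P x y) hy hxy
    exact ⟨y, (hf x y).2 ⟨hx, hy, hxy, hmin⟩⟩
  · obtain ⟨hx, -, h, -⟩ := (hf x y).1 h
    exact ⟨hx, h⟩
  · obtain ⟨-, hy, h1, h2⟩ := (hf x y).1 h
    obtain ⟨-, hy', h1', h2'⟩ := (hf x y').1 h'
    rcases hr.tri hy hy' with h | h | h
    · exact h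
    · exact absurd h1 (h2' _ hy h)
    · exact absurd h1' (h2 _ hy' h)

end Basic

/-! ### The set of natural numbers, recursion and iteration. -/

section Omega

/-- `y = x ∪ {x}` -/
def IsSucc {M : Type*} [MemJ M] (y x : M) : Prop := ∀ z, z ∈ y ↔ z ∈ x ∨ z = x

/-- `x = ∅` -/
def IsEmp {M : Type*} [MemJ M] (x : M) : Prop := ∀ z, z ∉ x

instance {M : Type*} [MemJ M] {b : Bool} {s t : (ℕ → M) → M} [Tm b s] [Tm b t] :
    Dfn b (fun v => IsSucc (s v) (t v)) :=
  Dfn.subst₂ (by unfold IsSucc; infer_instance) s t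

instance {M : Type*} [MemJ M] {b : Bool} {s : (ℕ → M) → M} [Tm b s] :
    Dfn b (fun v => IsEmp (s v)) :=
  Dfn.subst₁ (by unfold IsEmp; infer_instance) s

/-- `w` is an inductive set. -/
def Ind {M : Type*} [MemJ M] (w : M) : Prop :=
  (∃ x ∈ w, IsEmp x) ∧ ∀ x ∈ w, ∃ y ∈ w, IsSucc y x

instance {M : Type*} [MemJ M] {b : Bool} {s : (ℕ → M) → M} [Tm b s] :
    Dfn b (fun v => Ind (s v)) :=
  Dfn.subst₁ (by unfold Ind; infer_instance) s

/-- `w = ω` -/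
def IsOmega {M : Type*} [MemJ M] (w : M) : Prop :=
  Ind w ∧ ∀ u : M, Ind u → ∀ x ∈ w, x ∈ u

instance {M : Type*} [MemJ M] {b : Bool} {s : (ℕ → M) → M} [Tm b s] :
    Dfn b (fun v => IsOmega (s v)) :=
  Dfn.subst₁ (by unfold IsOmega; infer_instance) s

variable {M : Type*} [ZFCj M] {ω : M}

theorem IsEmp.unique {x y : M} (hx : IsEmp x) (hy : IsEmp y) : x = y :=
  set_ext fun z => iff_of_false (hx z) (hy z)

theorem IsSucc.unique {x y y' : M} (h : IsSucc y x) (h' : IsSucc y' x) : y = y' :=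
  set_ext fun z => (h z).trans (h' z).symm

theorem exists_isOmega : ∃ w : M, IsOmega w := by
  obtain ⟨w, ⟨e, he, hemp⟩, hw⟩ := ZFCj.infinity (M := M)
  have hind : Ind w := ⟨⟨e, he, hemp⟩, hw⟩
  obtain ⟨o, ho⟩ := ZFCj.sep (fun x => ∀ u : M, Ind u → x ∈ u) w
  refine ⟨o, ⟨⟨e, (ho e).2 ⟨he, fun u hu => ?_⟩, hemp⟩, fun x hx => ?_⟩,
    fun u hu x hx => ((ho x).1 hx).2 u hu⟩
  · obtain ⟨e', he', h⟩ := hu.1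
    exact h.unique hemp ▸ he'
  · obtain ⟨hxw, hxu⟩ := (ho x).1 hx
    obtain ⟨y, hy, hyx⟩ := hw x hxw
    refine ⟨y, (ho y).2 ⟨hy, fun u hu => ?_⟩, hyx⟩
    obtain ⟨y', hy', h⟩ := hu.2 x (hxu u hu)
    exact h.unique hyx ▸ hy'

/-- The predicate may mention `j`, because Separation holds for $\{\in,j\}$; this is what
`IsOmega.j_nat` needs. -/
theorem IsOmega.induction (hω : IsOmega ω) (P : M → Prop) [Dfn true (fun v => P (v 0))]
    (h0 : ∀ x ∈ ω, IsEmp x → P x) (hS : ∀ x ∈ ω, P x → ∀ y ∈ ω, IsSucc y x → P y) :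
    ∀ x ∈ ω, P x := by
  obtain ⟨u, hu⟩ := ZFCj.sep P ω
  have : Ind u := by
    refine ⟨?_, fun x hx => ?_⟩
    · obtain ⟨e, he, h⟩ := hω.1.1
      exact ⟨e, (hu e).2 ⟨he, h0 e he h⟩, h⟩
    · obtain ⟨hxω, hP⟩ := (hu x).1 hx
      obtain ⟨y, hy, hyx⟩ := hω.1.2 x hxω
      exact ⟨y, (hu y).2 ⟨hy, hS x hxω hP y hy hyx⟩, hyx⟩
  exact fun x hx => ((hu x).1 (hω.2 u this x hx)).2

theorem IsOmega.unique {w w' : M} (h : IsOmega w) (h' : IsOmega w') : w = w' :=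
  set_ext fun x => ⟨h.2 w' h'.1 x, h'.2 w h.1 x⟩

theorem IsOmega.j_eq (hω : IsOmega ω) : j ω = ω :=
  ((elem₁ (fun x => IsOmega x) ω).1 hω).unique hω

theorem IsOmega.j_nat (hω : IsOmega ω) : ∀ n ∈ ω, j n = n := by
  refine hω.induction (fun n => j n = n) (fun x _ hx => ?_) fun x _ hx y _ hy => ?_
  · exact ((elem₁ (fun x => IsEmp x) x).1 hx).unique hx
  · have := (elem₂ (fun y x => IsSucc y x) y x).1 hy
    rw [hx] at this
    exact this.unique hy

theorem IsOmega.transitive (hω : IsOmega ω) : ∀ n ∈ ω, ∀ m ∈ n, ∀ k ∈ m, k ∈ n := by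
  refine hω.induction (fun n => ∀ m ∈ n, ∀ k ∈ m, k ∈ n) (fun x _ hx m hm => absurd hm (hx m))
    fun x hxω hx y _ hy m hm k hk => ?_
  rcases (hy m).1 hm with h | rfl
  · exact (hy k).2 (.inl (hx m h k hk))
  · exact (hy k).2 (.inl hk)

theorem IsOmega.succ_mem (hω : IsOmega ω) : ∀ m ∈ ω, ∀ n ∈ m, ∀ k, IsSucc k n → k = m ∨ k ∈ m := by
  refine hω.induction (fun m => ∀ n ∈ m, ∀ k, IsSucc k n → k = m ∨ k ∈ m)
    (fun x _ hx m hm => absurd hm (hx m)) fun x hxω hx y _ hy n hn k hk => ?_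
  rcases (hy n).1 hn with h | rfl
  · rcases hx n h k hk with rfl | h
    · exact .inr ((hy _).2 (.inr rfl))
    · exact .inr ((hy _).2 (.inl h))
  · exact .inl (hk.unique hy)

theorem IsOmega.zero_mem (hω : IsOmega ω) {e : M} (he : IsEmp e) : ∀ m ∈ ω, m = e ∨ e ∈ m := by
  refine hω.induction (fun m => m = e ∨ e ∈ m) (fun x _ hx => .inl (hx.unique he))
    fun x hxω hx y _ hy => .inr ?_
  rcases hx with rfl | h
  · exact (hy _).2 (.inr rfl)
  · exact (hy _).2 (.inl h)

theorem IsOmega.trichotomy (hω : IsOmega ω) : ∀ n ∈ ω, ∀ m ∈ ω, m = n ∨ m ∈ n ∨ n ∈ m := by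
  refine hω.induction (fun n => ∀ m ∈ ω, m = n ∨ m ∈ n ∨ n ∈ m) (fun x hxω hx m hm => ?_)
    fun x hxω hx y hyω hy m hm => ?_
  · rcases hω.zero_mem hx m hm with h | h <;> simp [h]
  · rcases hx m hm with rfl | h | h
    · exact .inr (.inl ((hy _).2 (.inr rfl)))
    · exact .inr (.inl ((hy _).2 (.inl h)))
    · rcases hω.succ_mem m hm x h y hy with h | h
      · exact .inl h.symm
      · exact .inr (.inr h)

theorem IsOmega.exists_wo (hω : IsOmega ω) :
    ∃ r, WO ω r ∧ ∀ x y, App r x y ↔ x ∈ ω ∧ y ∈ ω ∧ x ∈ y := by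
  obtain ⟨r, hr⟩ := exists_rel ω ω (fun x y => x ∈ y)
  refine ⟨r, ⟨fun x _ h => ?_, fun x hx y hy z hz hxy hyz => ?_, fun x hx y hy => ?_,
    fun s hs hne => ?_⟩, hr⟩
  · exact not_mem_self x ((hr x x).1 h).2.2
  · exact (hr x z).2 ⟨hx, hz, hω.transitive z hz y ((hr y z).1 hyz).2.2 x ((hr x y).1 hxy).2.2⟩
  · rcases hω.trichotomy y hy x hx with h | h | h
    · exact .inl h
    · exact .inr (.inl ((hr x y).2 ⟨hx, hy, h⟩))
    · exact .inr (.inr ((hr y x).2 ⟨hy, hx, h⟩))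
  · obtain ⟨m, hm, h⟩ := ZFCj.found s hne
    refine ⟨m, hm, fun y hy => ?_⟩
    rcases hω.trichotomy m (hs m hm) y (hs y hy) with h' | h' | h'
    · exact .inl h'
    · exact absurd hy (h y h')
    · exact .inr ((hr m y).2 ⟨hs m hm, hs y hy, h'⟩)

/-- Recursion along a well-order, for partial class functions. -/
theorem WO.exists_rec {A r : M} (hA : WO A r) (S : M → M → M → Prop)
    [Dfn true (fun v => S (v 0) (v 1) (v 2))]
    (hext : ∀ g g', ∀ w ∈ A, (∀ w' ∈ A, App r w' w → ∀ y, App g w' y ↔ App g' w' y) →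
      ∀ y, S g w y → S g' w y)
    (huniq : ∀ g, ∀ w ∈ A, ∀ y y', S g w y → S g w y' → y = y') :
    ∃ g : M, ∀ w y, App g w y ↔ w ∈ A ∧ S g w y := by
  have dS : ∀ (s t u : (ℕ → M) → M) [Tm true s] [Tm true t] [Tm true u],
      Dfn true (fun v => S (s v) (t v) (u v)) := Dfn.subst₃ inferInstance
  have hext' : ∀ g g', ∀ w ∈ A, (∀ w' ∈ A, App r w' w → ∀ y, App g w' y ↔ App g' w' y) →
      ∀ y, S g w y ↔ S g' w y := fun g g' w hw h y =>
    ⟨hext g g' w hw h y, hext g' g w hw (fun w' hw' hr y => (h w' hw' hr y).symm) y⟩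
  -- Two attempts that obey the recursion up to `w` coincide there: look at a least disagreement.
  have agree : ∀ g g', ∀ w ∈ A,
      (∀ w' ∈ A, w' = w ∨ App r w' w → ∀ y, App g w' y ↔ S g w' y) →
      (∀ w' ∈ A, w' = w ∨ App r w' w → ∀ y, App g' w' y ↔ S g' w' y) →
      ∀ w' ∈ A, w' = w ∨ App r w' w → ∀ y, App g w' y ↔ App g' w' y := by
    intro g g' w hw h h'
    by_contra! ⟨u, hu, huw, hne⟩
    obtain ⟨m, hm, ⟨hmw, hne⟩, hmin⟩ := hA.exists_min
      (fun u => (u = w ∨ App r u w) ∧ ¬ ∀ y, App g u y ↔ App g' u y) hu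
      ⟨huw, by
        intro h
        obtain ⟨y, hy⟩ := hne
        have := h y
        tauto⟩
    refine hne fun y => (h m hm hmw y).trans (Iff.trans ?_ (h' m hm hmw y).symm)
    refine hext' g g' m hm (fun u hu hum => ?_) y
    by_contra hc
    refine hmin u hu hum ⟨.inr ?_, hc⟩
    rcases hmw with rfl | hmw
    · exact hum
    · exact hA.trans hu hm hw hum hmw
  obtain ⟨G, hG⟩ := exists_graph A (fun w y => ∃ g,
      (∀ w' ∈ A, w' = w ∨ App r w' w → ∀ y, App g w' y ↔ S g w' y) ∧ App g w y) (by
    rintro w hw y y' ⟨g, hg, hy⟩ ⟨g', hg', hy'⟩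
    rw [← agree g g' w hw hg hg' w hw (.inl rfl), hg w hw (.inl rfl)] at hy'
    rw [hg w hw (.inl rfl)] at hy
    exact huniq g w hw _ _ hy hy')
  refine ⟨G, fun w y => ⟨fun h => ⟨((hG w y).1 h).1, ?_⟩, fun h => ?_⟩⟩
  all_goals
    -- At a least `m` where `G` fails, `G` below `m` together with the prescribed value at `m` is an
    -- attempt, so `G` has that value after all.
    have key : ∀ w ∈ A, ∀ y, App G w y ↔ S G w y := by
      clear h y w
      by_contra! ⟨u, hu, hne⟩
      obtain ⟨m, hm, hne, hmin⟩ := hA.exists_min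
        (fun u => ¬ ∀ y, App G u y ↔ S G u y) hu (by
          intro h
          obtain ⟨y, hy⟩ := hne
          have := h y
          tauto)
      obtain ⟨g, hg⟩ := exists_graph A
        (fun w y => (App r w m ∧ App G w y) ∨ (w = m ∧ S G m y)) (by
        rintro w hw y y' (⟨h, h1⟩ | ⟨rfl, h1⟩) (⟨h', h1'⟩ | ⟨h', h1'⟩)
        · have h2 := hmin w hw h
          rw [not_not] at h2
          rw [h2] at h1 h1'
          exact huniq G w hw _ _ h1 h1'
        · exact absurd (h' ▸ h) (hA.irrefl hm)
        · exact absurd h' (hA.irrefl hw)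
        · exact huniq G _ hw _ _ h1 h1')
      have hlt : ∀ u ∈ A, App r u m → ∀ y, App g u y ↔ App G u y := by
        intro u hu hum y
        rw [hg]
        refine ⟨?_, fun h => ⟨hu, .inl ⟨hum, h⟩⟩⟩
        rintro ⟨-, h | ⟨rfl, -⟩⟩
        · exact h.2
        · exact absurd hum (hA.irrefl hu)
      have hm' : ∀ y, App g m y ↔ S G m y := by
        intro y
        rw [hg]
        refine ⟨?_, fun h => ⟨hm, .inr ⟨rfl, h⟩⟩⟩
        rintro ⟨-, h | h⟩
        · exact absurd h.1 (hA.irrefl hm)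
        · exact h.2
      have hatt : ∀ u ∈ A, u = m ∨ App r u m → ∀ y, App g u y ↔ S g u y := by
        rintro u hu (rfl | hum) y
        · rw [hm']
          exact (hext' g G u hu hlt y).symm
        · rw [hlt u hu hum, not_not.1 (hmin u hu hum) y]
          exact (hext' g G u hu (fun k hk hku => hlt k hk (hA.trans hk hu hm hku hum)) y).symm
      refine hne fun y => ?_
      rw [← hm', hG]
      refine ⟨?_, fun h => ⟨hm, g, hatt, h⟩⟩
      rintro ⟨-, g', hg', h⟩
      exact (agree g g' m hm hatt hg' m hm (.inl rfl) y).2 h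
  · exact (key w ((hG w y).1 h).1 y).1 h
  · exact (key w h.1 y).2 h.2

/-- Iteration of a class function. -/
theorem IsOmega.exists_iterate (hω : IsOmega ω) (Φ : M → M → Prop)
    [Dfn true (fun v => Φ (v 0) (v 1))] (Q : M → Prop) [Dfn true (fun v => Q (v 0))]
    (hΦ : ∀ x y y', Φ x y → Φ x y' → y = y') (hQ : ∀ x, Q x → ∃ y, Φ x y ∧ Q y)
    (a : M) (ha : Q a) :
    ∃ s : M, (∀ n y, App s n y → n ∈ ω ∧ Q y) ∧ (∀ n ∈ ω, ∃ y, App s n y) ∧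
      (∀ n y y', App s n y → App s n y' → y = y') ∧ (∀ n ∈ ω, IsEmp n → App s n a) ∧
      ∀ n ∈ ω, ∀ m ∈ ω, IsSucc m n → ∀ x y, App s n x → App s m y → Φ x y := by
  have dΦ : ∀ (s t : (ℕ → M) → M) [Tm true s] [Tm true t], Dfn true (fun v => Φ (s v) (t v)) :=
    Dfn.subst₂ inferInstance
  have dQ : ∀ (s : (ℕ → M) → M) [Tm true s], Dfn true (fun v => Q (s v)) :=
    Dfn.subst₁ inferInstance
  obtain ⟨r, hr, hr'⟩ := hω.exists_wo
  have pred_unique : ∀ n ∈ ω, ∀ m ∈ ω, ∀ k, IsSucc k n → IsSucc k m → n = m := by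
    intro n hn m hm k h h'
    have h1 := (h' n).1 ((h n).2 (.inr rfl))
    have h2 := (h m).1 ((h' m).2 (.inr rfl))
    rcases h1 with h1 | h1
    · rcases h2 with h2 | h2
      · exact absurd (hω.transitive n hn m h2 n h1) (not_mem_self n)
      · exact h2.symm
    · exact h1
  have not_emp : ∀ {k n : M}, IsSucc k n → ¬ IsEmp k := fun h h' => h' _ ((h _).2 (.inr rfl))
  -- The clause that `x` is the only value makes the step single-valued for every relation `g`, as
  -- `WO.exists_rec` demands, not only for functions.
  have huniq : ∀ g, ∀ w ∈ ω, ∀ y y', (IsEmp w ∧ y = a ∨ ∃ m ∈ ω, IsSucc w m ∧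
      ∃ x, App g m x ∧ (∀ x', App g m x' → x' = x) ∧ Φ x y) →
      (IsEmp w ∧ y' = a ∨ ∃ m ∈ ω, IsSucc w m ∧
      ∃ x, App g m x ∧ (∀ x', App g m x' → x' = x) ∧ Φ x y') → y = y' := by
    rintro g w hw y y' (⟨h1, rfl⟩ | ⟨m, hm, h1, x, hx, hx', h⟩)
      (⟨h1', rfl⟩ | ⟨m', hm', h1', x', hx1, hx1', h'⟩)
    · rfl
    · exact absurd h1 (not_emp h1')
    · exact absurd h1' (not_emp h1)
    · obtain rfl := pred_unique m hm m' hm' w h1 h1'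
      obtain rfl := hx' _ hx1
      exact hΦ _ _ _ h h'
  obtain ⟨s, hs⟩ := hr.exists_rec (fun g n y => (IsEmp n ∧ y = a) ∨ ∃ m ∈ ω, IsSucc n m ∧
      ∃ x, App g m x ∧ (∀ x', App g m x' → x' = x) ∧ Φ x y) (by
    rintro g g' w hw h y (hy | ⟨m, hm, h1, x, hx, hx', h2⟩)
    · exact .inl hy
    · have hmw := h m hm ((hr' m w).2 ⟨hm, hw, (h1 m).2 (.inr rfl)⟩)
      exact .inr ⟨m, hm, h1, x, (hmw x).1 hx, fun x' h => hx' x' ((hmw x').2 h), h2⟩) huniq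
  have hfun : ∀ n y y', App s n y → App s n y' → y = y' := fun n y y' h h' =>
    huniq s n ((hs n y).1 h).1 y y' ((hs n y).1 h).2 ((hs n y').1 h').2
  have htot : ∀ n ∈ ω, ∃ y, App s n y ∧ Q y := by
    refine hω.induction (fun n => ∃ y, App s n y ∧ Q y) (fun x hx hx' => ?_)
      fun x hxω ⟨y, hy, hQy⟩ z hz hzx => ?_
    · exact ⟨a, (hs x a).2 ⟨hx, .inl ⟨hx', rfl⟩⟩, ha⟩
    · obtain ⟨u, hu, hu'⟩ := hQ y hQy
      exact ⟨u, (hs z u).2 ⟨hz, .inr ⟨x, hxω, hzx, y, hy, fun x' h => hfun x _ _ h hy, hu⟩⟩, hu'⟩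
  refine ⟨s, fun n y h => ?_, fun n hn => ?_, hfun, fun n hn h => (hs n a).2 ⟨hn, .inl ⟨h, rfl⟩⟩,
    fun n hn m hm h x y hx hy => ?_⟩
  · have hn := ((hs n y).1 h).1
    obtain ⟨y', hy', hQ'⟩ := htot n hn
    exact ⟨hn, hfun n _ _ hy' h ▸ hQ'⟩
  · obtain ⟨y, hy, -⟩ := htot n hn
    exact ⟨y, hy⟩
  · obtain ⟨-, ⟨h1, -⟩ | ⟨k, hk, h1, x', hx', hu, hΦ'⟩⟩ := (hs m y).1 hy
    · exact absurd h1 (not_emp h)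
    · obtain rfl := pred_unique k hk n hn m h1 h
      exact hu x hx ▸ hΦ'

end Omega

/-! ### The set `D`, injections and comparison of well-orders. -/

section Size

variable {M : Type*} [ZFCj M] {ω : M}

theorem exists_union (x y : M) : ∃ u : M, ∀ z, z ∈ u ↔ z ∈ x ∨ z ∈ y := by
  obtain ⟨p, hp⟩ := ZFCj.pairing x y
  obtain ⟨u, hu⟩ := ZFCj.union p
  refine ⟨u, fun z => (hu z).trans ⟨?_, ?_⟩⟩
  · rintro ⟨w, hw, hz⟩
    rcases (hp w).1 hw with rfl | rfl
    · exact .inl hz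
    · exact .inr hz
  · rintro (h | h)
    · exact ⟨x, (hp x).2 (.inl rfl), h⟩
    · exact ⟨y, (hp y).2 (.inr rfl), h⟩

/-- A transitive set `D` closed under pairs, with `j(D) ⊆ D` and `j '' D ≠ j(D)`. -/
theorem exists_closed_set (hω : IsOmega ω) :
    ∃ D : M, (∀ n ∈ ω, n ∈ D) ∧ (∀ x ∈ D, ∀ y ∈ D, ∀ p, IsOP p x y → p ∈ D) ∧
      (∀ x ∈ j D, x ∈ D) ∧ ∃ x ∈ j D, ∀ d ∈ D, j d ≠ x := by
  obtain ⟨x₀, hx₀⟩ := ZFCj.nontriv (M := M)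
  obtain ⟨a, ha⟩ := ZFCj.pairing x₀ ω
  obtain ⟨s, hs, htot, hfun, hzero, hsucc⟩ := hω.exists_iterate
    (fun s y => ∀ z, z ∈ y ↔ z ∈ s ∨ (∃ u ∈ s, z ∈ u) ∨ z ∈ j s ∨ ∃ u ∈ s, ∃ w ∈ s, IsOP z u w)
    (fun x => x = x) (fun x y y' h h' => set_ext fun z => (h z).trans (h' z).symm)
    (fun x _ => by
      obtain ⟨u, hu⟩ := ZFCj.union x
      obtain ⟨c, hc⟩ := exists_prod x x
      obtain ⟨e, he⟩ := exists_union x u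
      obtain ⟨f, hf⟩ := exists_union (j x) c
      obtain ⟨g, hg⟩ := exists_union e f
      refine ⟨g, fun z => ?_, rfl⟩
      rw [hg, he, hf, hu, hc, or_assoc]) a rfl
  obtain ⟨S, hS⟩ := exists_image ω (fun n y => App s n y) fun n _ y y' => hfun n y y'
  obtain ⟨D, hD'⟩ := ZFCj.union S
  have hD : ∀ x, x ∈ D ↔ ∃ n y, App s n y ∧ x ∈ y := by
    intro x
    rw [hD']
    constructor
    · rintro ⟨y, hy, hx⟩
      obtain ⟨n, -, h⟩ := (hS y).1 hy
      exact ⟨n, y, h, hx⟩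
    · rintro ⟨n, y, h, hx⟩
      exact ⟨y, (hS y).2 ⟨n, (hs n y h).1, h⟩, hx⟩
  have step : ∀ n y, App s n y → ∃ m ∈ ω, ∃ y', App s m y' ∧ IsSucc m n ∧
      ∀ z, z ∈ y' ↔ z ∈ y ∨ (∃ u ∈ y, z ∈ u) ∨ z ∈ j y ∨ ∃ u ∈ y, ∃ w ∈ y, IsOP z u w := by
    intro n y h
    have hn := (hs n y h).1
    obtain ⟨m, hm, hmn⟩ := hω.1.2 n hn
    obtain ⟨y', hy'⟩ := htot m hm
    exact ⟨m, hm, y', hy', hmn, hsucc n hn m hm hmn y y' h hy'⟩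
  have mono : ∀ m ∈ ω, ∀ n ∈ m, ∀ y y', App s n y → App s m y' → ∀ z ∈ y, z ∈ y' := by
    refine hω.induction (fun m => ∀ n ∈ m, ∀ y y', App s n y → App s m y' → ∀ z ∈ y, z ∈ y')
      (fun m _ hm n hn => absurd hn (hm n)) fun m hm ih k hk hkm n hn y y' hy hy' z hz => ?_
    obtain ⟨u, hu⟩ := htot m hm
    refine (hsucc m hm k hk hkm u y' hu hy' z).2 (.inl ?_)
    rcases (hkm n).1 hn with h | rfl
    · exact ih n h y u hy hu z hz
    · exact hfun _ _ _ hy hu ▸ hz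
  have htrans : ∀ x ∈ D, ∀ y ∈ x, y ∈ D := by
    intro x hx y hy
    obtain ⟨n, u, hu, hxu⟩ := (hD x).1 hx
    obtain ⟨m, hm, u', hu', -, h⟩ := step n u hu
    exact (hD y).2 ⟨m, u', hu', (h y).2 (.inr (.inl ⟨x, hxu, hy⟩))⟩
  have haD : ∀ x ∈ a, x ∈ D := by
    intro x hx
    obtain ⟨e, he, he'⟩ := hω.1.1
    exact (hD x).2 ⟨e, a, hzero e he he', hx⟩
  have hdir : ∀ x ∈ D, ∀ y ∈ D, ∃ n u, App s n u ∧ x ∈ u ∧ y ∈ u := by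
    intro x hx y hy
    obtain ⟨n, u, hu, hxu⟩ := (hD x).1 hx
    obtain ⟨m, w, hw, hyw⟩ := (hD y).1 hy
    have hn := (hs n u hu).1
    have hm := (hs m w hw).1
    rcases hω.trichotomy n hn m hm with rfl | h | h
    · exact ⟨m, u, hu, hxu, hfun _ _ _ hw hu ▸ hyw⟩
    · exact ⟨n, u, hu, hxu, mono n hn m h w u hw hu y hyw⟩
    · exact ⟨m, w, hw, mono m hm n h u w hu hw x hxu, hyw⟩
  refine ⟨D, fun n hn => htrans ω (haD ω ((ha ω).2 (.inr rfl))) n hn, fun x hx y hy p hp => ?_,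
    fun x hx => ?_, ?_⟩
  · obtain ⟨n, u, hu, hxu, hyu⟩ := hdir x hx y hy
    obtain ⟨m, hm, u', hu', -, h⟩ := step n u hu
    exact (hD p).2 ⟨m, u', hu', (h p).2 (.inr (.inr (.inr ⟨x, hxu, y, hyu, hp⟩)))⟩
  · have h1 := (elem₂ (fun D s => ∀ x, x ∈ D ↔ ∃ n y, App s n y ∧ x ∈ y) D s).1 hD
    have h2 := (elem₂ (fun s o => ∀ n y, App s n y → n ∈ o) s ω).1 fun n y h => (hs n y h).1
    have h3 := (elem₁ (fun s => ∀ n y y', App s n y → App s n y' → y = y') s).1 hfun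
    obtain ⟨n, y, hy, hxy⟩ := (h1 x).1 hx
    have hn := h2 n y hy
    rw [hω.j_eq] at hn
    obtain ⟨u, hu⟩ := htot n hn
    have h4 := (elem₃ (fun s n u => App s n u) s n u).1 hu
    rw [hω.j_nat n hn] at h4
    obtain rfl := h3 n _ _ h4 hy
    obtain ⟨m, hm, u', hu', -, h⟩ := step n u hu
    exact (hD x).2 ⟨m, u', hu', (h x).2 (.inr (.inr (.inl hxy)))⟩
  · by_contra! hc
    have hjtrans := (elem₁ (fun D => ∀ x ∈ D, ∀ y ∈ x, y ∈ D) D).1 htrans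
    obtain ⟨t, ht⟩ := ZFCj.sep (fun x => j x ≠ x) D
    -- Take an `∈`-minimal moved `m`. If $j''D$ were all of $j(D)$, each element of $j(m)$ would be
    -- $j(d)=d$ for some $d\in m$, whence $j(m)=m$.
    obtain ⟨m, hm, hmin⟩ := ZFCj.found t ⟨x₀, (ht x₀).2 ⟨haD x₀ ((ha x₀).2 (.inl rfl)), hx₀⟩⟩
    obtain ⟨hmD, hjm⟩ := (ht m).1 hm
    have hfix : ∀ z ∈ m, j z = z := fun z hz => by
      by_contra h
      exact hmin z hz ((ht z).2 ⟨htrans m hmD z hz, h⟩)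
    refine hjm (set_ext fun z => ⟨fun hz => ?_, fun hz => ?_⟩)
    · obtain ⟨d, hd, rfl⟩ := hc z (hjtrans _ (j_mem_iff.2 hmD) z hz)
      have := j_mem_iff.1 hz
      rwa [hfix d this]
    · exact hfix z hz ▸ j_mem_iff.2 hz

/-- There is an injection from `A` to `B`, possibly multi-valued. -/
def Inj {M : Type*} [MemJ M] (A B : M) : Prop :=
  ∃ f, (∀ x ∈ A, ∃ y ∈ B, App f x y) ∧
    ∀ x ∈ A, ∀ x' ∈ A, ∀ y ∈ B, App f x y → App f x' y → x = x'

instance {M : Type*} [MemJ M] {b : Bool} {s t : (ℕ → M) → M} [Tm b s] [Tm b t] :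
    Dfn b (fun v => Inj (s v) (t v)) :=
  Dfn.subst₂ (by unfold Inj; infer_instance) s t

theorem Inj.intro {A B : M} (P : M → M → Prop) [Dfn true (fun v => P (v 0) (v 1))]
    (h : ∀ x ∈ A, ∃ y ∈ B, P x y)
    (h' : ∀ x ∈ A, ∀ x' ∈ A, ∀ y ∈ B, P x y → P x' y → x = x') : Inj A B := by
  obtain ⟨f, hf⟩ := exists_rel A B P
  refine ⟨f, fun x hx => ?_, fun x hx x' hx' y hy h1 h2 =>
    h' x hx x' hx' y hy ((hf x y).1 h1).2.2 ((hf x' y).1 h2).2.2⟩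
  obtain ⟨y, hy, hxy⟩ := h x hx
  exact ⟨y, hy, (hf x y).2 ⟨hx, hy, hxy⟩⟩

theorem Inj.trans {A B C : M} (h : Inj A B) (h' : Inj B C) : Inj A C := by
  obtain ⟨f, hf, hf'⟩ := h
  obtain ⟨g, hg, hg'⟩ := h'
  refine Inj.intro (fun x z => ∃ y ∈ B, App f x y ∧ App g y z) (fun x hx => ?_) ?_
  · obtain ⟨y, hy, hxy⟩ := hf x hx
    obtain ⟨z, hz, hyz⟩ := hg y hy
    exact ⟨z, hz, y, hy, hxy, hyz⟩
  · rintro x hx x' hx' z hz ⟨y, hy, h1, h2⟩ ⟨y', hy', h1', h2'⟩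
    obtain rfl := hg' y hy y' hy' z hz h2 h2'
    exact hf' x hx x' hx' y hy h1 h1'

theorem Inj.of_subset {A B : M} (h : ∀ x ∈ A, x ∈ B) : Inj A B :=
  Inj.intro (fun x y => x = y) (fun x hx => ⟨x, h x hx, rfl⟩)
    (fun _ _ _ _ _ _ h h' => h.trans h'.symm)

/-- If `D` is closed under pairs, then a union of `D` many sets that inject into `D` injects
into `D`. -/
theorem Inj.iUnion {D A : M} (hD : ∀ x ∈ D, ∀ y ∈ D, ∀ p, IsOP p x y → p ∈ D)
    (R : M → M → Prop) [Dfn true (fun v => R (v 0) (v 1))] (hA : ∀ x ∈ A, ∃ i ∈ D, R i x)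
    (h : ∀ i ∈ D, ∀ B : M, (∀ x, x ∈ B ↔ x ∈ A ∧ R i x) → Inj B D) : Inj A D := by
  have dR : ∀ (s t : (ℕ → M) → M) [Tm true s] [Tm true t], Dfn true (fun v => R (s v) (t v)) :=
    Dfn.subst₂ inferInstance
  obtain ⟨F, hF, hF1, hF2⟩ := exists_choice D (fun i f => (∀ x ∈ A, R i x → ∃ y ∈ D, App f x y) ∧
    ∀ x ∈ A, R i x → ∀ x' ∈ A, R i x' → ∀ y ∈ D, App f x y → App f x' y → x = x') (by
      intro i hi
      obtain ⟨B, hB⟩ := ZFCj.sep (fun x => R i x) A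
      obtain ⟨f, hf, hf'⟩ := h i hi B hB
      exact ⟨f, fun x hx hR => hf x ((hB x).2 ⟨hx, hR⟩), fun x hx hR x' hx' hR' =>
        hf' x ((hB x).2 ⟨hx, hR⟩) x' ((hB x').2 ⟨hx', hR'⟩)⟩)
  -- Send `x` to the pair of `i` and $f_i(x)$, for every index `i` of `x`: multi-valuedness spares
  -- the choice of one.
  refine Inj.intro (fun x z => ∃ i ∈ D, R i x ∧ ∃ f, App F i f ∧ ∃ y ∈ D, App f x y ∧ IsOP z i y)
    (fun x hx => ?_) ?_
  · obtain ⟨i, hi, hR⟩ := hA x hx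
    obtain ⟨f, hf⟩ := hF i hi
    obtain ⟨y, hy, hxy⟩ := (hF1 i f hf).2.1 x hx hR
    obtain ⟨z, hz⟩ := exists_isOP i y
    exact ⟨z, hD i hi y hy z hz, i, hi, hR, f, hf, y, hy, hxy, hz⟩
  · rintro x hx x' hx' z hz ⟨i, hi, hR, f, hf, y, hy, hxy, hp⟩ ⟨i', hi', hR', f', hf', y', hy',
      hxy', hp'⟩
    obtain ⟨rfl, rfl⟩ := isOP_inj hp hp'
    obtain rfl := hF2 _ _ _ hf hf'
    exact (hF1 i f hf).2.2 x hx hR x' hx' hR' y hy hxy hxy'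

/-- `g` is a bisimulation between the relations `r` on `A` and `s` on `B`. -/
def Bisim {M : Type*} [MemJ M] (A r B s g : M) : Prop :=
  ∀ x y, App g x y → x ∈ A ∧ y ∈ B ∧
    (∀ x' ∈ A, App r x' x → ∃ y' ∈ B, App s y' y ∧ App g x' y') ∧
    ∀ y' ∈ B, App s y' y → ∃ x' ∈ A, App r x' x ∧ App g x' y'

instance {M : Type*} [MemJ M] {b : Bool} {s t u w x : (ℕ → M) → M} [Tm b s] [Tm b t] [Tm b u]
    [Tm b w] [Tm b x] : Dfn b (fun v => Bisim (s v) (t v) (u v) (w v) (x v)) :=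
  Dfn.subst₅ (by unfold Bisim; infer_instance) s t u w x

/-- At a least point with two images, the smaller image comes from a point below, which then again
has two distinct images. With `g = g'` this shows that a bisimulation is single-valued. -/
theorem Bisim.unique_right {A r B s g g' : M} (hA : WO A r) (hB : WO B s) (hg : Bisim A r B s g)
    (hg' : Bisim A r B s g') {x y y' : M} (h : App g x y) (h' : App g' x y') : y = y' := by
  by_contra hne
  obtain ⟨m, hm, ⟨y, y', h, h', hne⟩, hmin⟩ := hA.exists_min
    (fun x => ∃ y y', App g x y ∧ App g' x y' ∧ y ≠ y') (hg x y h).1 ⟨y, y', h, h', hne⟩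
  obtain ⟨-, hy, h1, h2⟩ := hg m y h
  obtain ⟨-, hy', h1', h2'⟩ := hg' m y' h'
  rcases hB.tri hy hy' with h3 | h3 | h3
  · exact hne h3
  · obtain ⟨x, hx, hxm, hxy⟩ := h2' y hy h3
    obtain ⟨z, hz, hzy, hxz⟩ := h1 x hx hxm
    refine hmin x hx hxm ⟨z, y, hxz, hxy, ?_⟩
    rintro rfl
    exact hB.irrefl hz hzy
  · obtain ⟨x, hx, hxm, hxy⟩ := h2 y' hy' h3
    obtain ⟨z, hz, hzy, hxz⟩ := h1' x hx hxm
    refine hmin x hx hxm ⟨y', z, hxy, hxz, ?_⟩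
    rintro rfl
    exact hB.irrefl hz hzy

theorem Bisim.unique_left {A r B s g g' : M} (hA : WO A r) (hB : WO B s) (hg : Bisim A r B s g)
    (hg' : Bisim A r B s g') {x x' y : M} (h : App g x y) (h' : App g' x' y) : x = x' := by
  rcases hA.tri (hg x y h).1 (hg' x' y h').1 with h1 | h1 | h1
  · exact h1
  · obtain ⟨z, hz, hzy, hxz⟩ := (hg' x' y h').2.2.1 x (hg x y h).1 h1
    obtain rfl := Bisim.unique_right hA hB hg hg' h hxz
    exact absurd hzy (hB.irrefl hz)
  · obtain ⟨z, hz, hzy, hxz⟩ := (hg x y h).2.2.1 x' (hg' x' y h').1 h1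
    obtain rfl := Bisim.unique_right hA hB hg hg' hxz h'
    exact absurd hzy (hB.irrefl hz)

/-- Comparability of well-orders: the largest bisimulation is total or onto. -/
theorem WO.exists_bisim {A r B s : M} (hA : WO A r) (hB : WO B s) :
    ∃ g, Bisim A r B s g ∧ ((∀ x ∈ A, ∃ y, App g x y) ∨ ∀ y ∈ B, ∃ x, App g x y) := by
  obtain ⟨g, hg⟩ := exists_rel A B (fun x y => ∃ g, Bisim A r B s g ∧ App g x y)
  have hbis : Bisim A r B s g := by
    intro x y h
    obtain ⟨hx, hy, k, hk, hxy⟩ := (hg x y).1 h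
    obtain ⟨-, -, h1, h2⟩ := hk x y hxy
    refine ⟨hx, hy, fun x' hx' hr => ?_, fun y' hy' hs => ?_⟩
    · obtain ⟨y', hy', hs, h⟩ := h1 x' hx' hr
      exact ⟨y', hy', hs, (hg x' y').2 ⟨hx', hy', k, hk, h⟩⟩
    · obtain ⟨x', hx', hr, h⟩ := h2 y' hy' hs
      exact ⟨x', hx', hr, (hg x' y').2 ⟨hx', hy', k, hk, h⟩⟩
  refine ⟨g, hbis, ?_⟩
  -- Otherwise the pair of the least points missed on either side can be adjoined to `g`.
  by_contra! ⟨⟨a₀, ha₀, ha₀'⟩, b₀, hb₀, hb₀'⟩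
  obtain ⟨a, ha, ha', hamin⟩ := hA.exists_min (fun x => ∀ y, ¬ App g x y) ha₀ ha₀'
  obtain ⟨b, hb, hb', hbmin⟩ := hB.exists_min (fun y => ∀ x, ¬ App g x y) hb₀ hb₀'
  obtain ⟨k, hk⟩ := exists_rel A B (fun x y => App g x y ∨ (x = a ∧ y = b))
  refine ha' b ((hg a b).2 ⟨ha, hb, k, fun x y hxy => ?_, (hk a b).2 ⟨ha, hb, .inr ⟨rfl, rfl⟩⟩⟩)
  obtain ⟨hx, hy, hxy⟩ := (hk x y).1 hxy
  refine ⟨hx, hy, fun x' hx' hr => ?_, fun y' hy' hs => ?_⟩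
  · rcases hxy with hxy | ⟨rfl, rfl⟩
    · obtain ⟨y', hy', hs, h⟩ := (hbis x y hxy).2.2.1 x' hx' hr
      exact ⟨y', hy', hs, (hk x' y').2 ⟨hx', hy', .inl h⟩⟩
    · obtain ⟨y', h⟩ := not_forall_not.1 (hamin x' hx' hr)
      have hy' := (hbis x' y' h).2.1
      refine ⟨y', hy', ?_, (hk x' y').2 ⟨hx', hy', .inl h⟩⟩
      rcases hB.tri hy' hb with rfl | h1 | h1
      · exact absurd h (hb' x')
      · exact h1
      · obtain ⟨z, -, -, hz⟩ := (hbis x' y' h).2.2.2 _ hb h1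
        exact absurd hz (hb' z)
  · rcases hxy with hxy | ⟨rfl, rfl⟩
    · obtain ⟨x', hx', hr, h⟩ := (hbis x y hxy).2.2.2 y' hy' hs
      exact ⟨x', hx', hr, (hk x' y').2 ⟨hx', hy', .inl h⟩⟩
    · obtain ⟨x', h⟩ := not_forall_not.1 (hbmin y' hy' hs)
      have hx' := (hbis x' y' h).1
      refine ⟨x', hx', ?_, (hk x' y').2 ⟨hx', hy', .inl h⟩⟩
      rcases hA.tri hx' ha with rfl | h1 | h1
      · exact absurd h (ha' y')
      · exact h1
      · obtain ⟨z, -, -, hz⟩ := (hbis x' y' h).2.2.1 _ ha h1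
        exact absurd hz (ha' z)

theorem Inj.total (A B : M) : Inj A B ∨ Inj B A := by
  obtain ⟨r, hr⟩ := ZFCj.wo A
  obtain ⟨s, hs⟩ := ZFCj.wo B
  obtain ⟨g, hg, h | h⟩ := hr.exists_bisim hs
  · refine .inl ⟨g, fun x hx => ?_, fun x _ x' _ y _ => hg.unique_left hr hs hg⟩
    obtain ⟨y, hy⟩ := h x hx
    exact ⟨y, (hg x y hy).2.1, hy⟩
  · refine .inr (Inj.intro (fun y x => App g x y) (fun y hy => ?_)
      fun y _ y' _ x _ h h' => hg.unique_right hr hs hg h h')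
    obtain ⟨x, hx⟩ := h y hy
    exact ⟨x, (hg x y hx).1, hx⟩

end Size

/-! ### The case where every set injects into `D`. -/

section LargestSize

variable {M : Type*} [ZFCj M]

/-- Some well-ordered set of the size of `D` has only initial segments of smaller size. -/
theorem exists_initial_wo (D : M) : ∃ W r : M, WO W r ∧ Inj D W ∧
    ∀ w ∈ W, ∀ S : M, (∀ x, x ∈ S ↔ x ∈ W ∧ App r x w) → ¬ Inj D S := by
  obtain ⟨r, hr⟩ := ZFCj.wo D
  -- Keep the points whose segment does not receive `D`. If some point is dropped, the segment of
  -- the least such one lies in `W` and receives `D`.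
  obtain ⟨W, hW⟩ := ZFCj.sep (fun y => ∀ S : M, (∀ x, x ∈ S ↔ x ∈ D ∧ App r x y) → ¬ Inj D S) D
  have hsub : ∀ x ∈ W, x ∈ D := fun x hx => ((hW x).1 hx).1
  refine ⟨W, r, hr.mono hsub, ?_, fun w hw S hS h => ?_⟩
  · by_cases hDW : ∀ x ∈ D, x ∈ W
    · exact Inj.of_subset hDW
    push Not at hDW
    obtain ⟨x, hx, hxW⟩ := hDW
    obtain ⟨m, hm, hmW, hmin⟩ := hr.exists_min (fun x => x ∉ W) hx hxW
    rw [hW] at hmW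
    push Not at hmW
    obtain ⟨S, hS, h⟩ := hmW hm
    exact h.trans (Inj.of_subset fun z hz => by
      obtain ⟨hzD, hzm⟩ := (hS z).1 hz
      exact not_not.1 (hmin z hzD hzm))
  · obtain ⟨hwD, hw'⟩ := (hW w).1 hw
    obtain ⟨S', hS'⟩ := ZFCj.sep (fun x => App r x w) D
    exact hw' S' hS' (h.trans (Inj.of_subset fun z hz =>
      (hS' z).2 ⟨hsub z ((hS z).1 hz).1, ((hS z).1 hz).2⟩))

/-- If every set injects into `D`, then some partial function from a set to `D` is onto `D` on
each large element of `b`. -/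
theorem exists_transversal {D : M} (hall : ∀ X : M, Inj X D) (b : M) :
    ∃ F : M, (∀ x ∈ b, Inj D x → ∀ β ∈ D, ∃ y ∈ x, App F y β) ∧
      (∀ y β β', App F y β → App F y β' → β = β') ∧ ∀ y β, App F y β → β ∈ D := by
  obtain ⟨W, r, hr, hDW, hseg⟩ := exists_initial_wo D
  obtain ⟨c, hc⟩ := exists_prod b D
  -- Bookkeeping: each task `(x, β)` gets a stage in `W`, and no stage serves two tasks. At its
  -- stage the least element of `x` not yet used is picked, and `F` will send it to `β`.
  obtain ⟨θ, hθ, hθ'⟩ := (hall c).trans hDW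
  obtain ⟨U, hU⟩ := ZFCj.union b
  obtain ⟨u, hu⟩ := ZFCj.wo U
  have hθu : ∀ w ∈ W, ∀ x ∈ b, ∀ β ∈ D, ∀ p, IsOP p x β → App θ p w →
      ∀ x' ∈ b, ∀ β' ∈ D, ∀ p', IsOP p' x' β' → App θ p' w → x = x' ∧ β = β' := by
    intro w hw x hx β hβ p hp h x' hx' β' hβ' p' hp' h'
    obtain rfl := hθ' p ((hc p).2 ⟨x, hx, β, hβ, hp⟩) p' ((hc p').2 ⟨x', hx', β', hβ', hp'⟩)
      w hw h h'
    exact isOP_inj hp hp'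
  obtain ⟨d, hd⟩ := hr.exists_rec (fun g w y => ∃ x ∈ b, ∃ β ∈ D, ∃ p, IsOP p x β ∧ App θ p w ∧
      y ∈ x ∧ (∀ w' ∈ W, App r w' w → ¬ App g w' y) ∧
      ∀ z ∈ x, (∀ w' ∈ W, App r w' w → ¬ App g w' z) → ¬ App u z y) (by
    rintro g g' w hw h y ⟨x, hx, β, hβ, p, hp, hpw, hy, h1, h2⟩
    exact ⟨x, hx, β, hβ, p, hp, hpw, hy, fun w' hw' hlt h3 => h1 w' hw' hlt ((h w' hw' hlt y).2 h3),
      fun z hz hz' => h2 z hz fun w' hw' hlt h3 => hz' w' hw' hlt ((h w' hw' hlt z).1 h3)⟩) (by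
    rintro g w hw y y' ⟨x, hx, β, hβ, p, hp, hpw, hy, h1, h2⟩
      ⟨x', hx', β', hβ', p', hp', hpw', hy', h1', h2'⟩
    obtain ⟨rfl, rfl⟩ := hθu w hw x hx β hβ p hp hpw x' hx' β' hβ' p' hp' hpw'
    rcases hu.tri ((hU y).2 ⟨x, hx, hy⟩) ((hU y').2 ⟨x, hx, hy'⟩) with h | h | h
    · exact h
    · exact absurd h (h2' y hy h1)
    · exact absurd h (h2 y' hy' h1'))
  have hdinj : ∀ w w' y, App d w y → App d w' y → w = w' := by
    intro w w' y h h'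
    obtain ⟨hw, -, -, -, -, -, -, -, -, h1, -⟩ := (hd w y).1 h
    obtain ⟨hw', -, -, -, -, -, -, -, -, h1', -⟩ := (hd w' y).1 h'
    rcases hr.tri hw hw' with h2 | h2 | h2
    · exact h2
    · exact absurd h (h1' w hw h2)
    · exact absurd h' (h1 w' hw' h2)
  have hdfun : ∀ w y y', App d w y → App d w y' → y = y' := by
    intro w y y' h h'
    obtain ⟨hw, x, hx, β, hβ, p, hp, hpw, hy, h1, h2⟩ := (hd w y).1 h
    obtain ⟨-, x', hx', β', hβ', p', hp', hpw', hy', h1', h2'⟩ := (hd w y').1 h'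
    obtain ⟨rfl, rfl⟩ := hθu w hw x hx β hβ p hp hpw x' hx' β' hβ' p' hp' hpw'
    rcases hu.tri ((hU y).2 ⟨x, hx, hy⟩) ((hU y').2 ⟨x, hx, hy'⟩) with h | h | h
    · exact h
    · exact absurd h (h2' y hy h1)
    · exact absurd h (h2 y' hy' h1')
  obtain ⟨F, hF⟩ := exists_rel U D (fun y β => ∃ w ∈ W, App d w y ∧
    ∃ x ∈ b, ∃ p, IsOP p x β ∧ App θ p w)
  refine ⟨F, fun x hx hDx β hβ => ?_, fun y β β' h h' => ?_, fun y β h => ((hF y β).1 h).2.1⟩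
  · obtain ⟨p, hp⟩ := exists_isOP x β
    obtain ⟨w, hw, hpw⟩ := hθ p ((hc p).2 ⟨x, hx, β, hβ, hp⟩)
    -- If `x` were exhausted by earlier picks, `D` would inject into the proper segment below `w`.
    have hex : ∃ z ∈ x, ∀ w' ∈ W, App r w' w → ¬ App d w' z := by
      by_contra! hcon
      obtain ⟨S, hS⟩ := ZFCj.sep (fun x => App r x w) W
      refine hseg w hw S hS (hDx.trans (Inj.intro (fun z w' => App d w' z) (fun z hz => ?_)
        fun z _ z' _ w' _ h h' => hdfun w' z z' h h'))
      obtain ⟨w', hw', hlt, h⟩ := hcon z hz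
      exact ⟨w', (hS w').2 ⟨hw', hlt⟩, h⟩
    obtain ⟨z, hz, hz'⟩ := hex
    obtain ⟨y, -, ⟨hyx, hy⟩, hmin⟩ := hu.exists_min
      (fun z => z ∈ x ∧ ∀ w' ∈ W, App r w' w → ¬ App d w' z) ((hU z).2 ⟨x, hx, hz⟩) ⟨hz, hz'⟩
    have hyU := (hU y).2 ⟨x, hx, hyx⟩
    refine ⟨y, hyx, (hF y β).2 ⟨hyU, hβ, w, hw, (hd w y).2 ⟨hw, x, hx, β, hβ, p, hp, hpw, hyx, hy,
      fun z hz hz' h => hmin z ((hU z).2 ⟨x, hx, hz⟩) h ⟨hz, hz'⟩⟩, x, hx, p, hp, hpw⟩⟩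
  · obtain ⟨-, hβ, w, hw, hwy, x, hx, p, hp, hpw⟩ := (hF y β).1 h
    obtain ⟨-, hβ', w', hw', hwy', x', hx', p', hp', hpw'⟩ := (hF y β').1 h'
    obtain rfl := hdinj w w' y hwy hwy'
    exact (hθu w hw x hx β hβ p hp hpw x' hx' β' hβ' p' hp' hpw').2

/-- If every set injects into a set `D` with `j '' D ≠ j(D)`, then `j` is not cofinal. -/
theorem not_cofinal_of_largest {D : M} (hall : ∀ X : M, Inj X D) {β : M} (hβ : β ∈ j D)
    (hβ' : ∀ d ∈ D, j d ≠ β) : ¬ ∀ a : M, ∃ b : M, a ∈ j b := by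
  intro hcof
  obtain ⟨a, ha⟩ := exists_image D (fun d y => y = j d) fun d _ y y' h h' => h.trans h'.symm
  obtain ⟨b, hb⟩ := hcof a
  obtain ⟨F, hF1, hF2, hF3⟩ := exists_transversal hall b
  have h1 := (elem₃ (fun b D F => ∀ x ∈ b, Inj D x → ∀ β ∈ D, ∃ y ∈ x, App F y β) b D F).1 hF1
  have h2 := (elem₁ (fun F => ∀ y β β', App F y β → App F y β' → β = β') F).1 hF2
  have hDa : Inj D a := Inj.intro (fun d y => y = j d)
    (fun d hd => ⟨j d, (ha _).2 ⟨d, hd, rfl⟩, rfl⟩)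
    fun d _ d' _ y _ h h' => j_inj.1 (h.symm.trans h')
  -- The set `a` is $j''D$, large enough in the sense of $j(D)$ because $j(D)$ injects into `D`; so
  -- $j(F)$ takes the value `β` on it.
  obtain ⟨y, hy, hyβ⟩ := h1 a hb ((hall (j D)).trans hDa) β hβ
  obtain ⟨d, hd, rfl⟩ := (ha y).1 hy
  obtain ⟨γ, hγ⟩ := (elem₂ (fun F d => ∃ γ, App F d γ) F d).2 ⟨β, hyβ⟩
  have h3 := (elem₃ (fun F d γ => App F d γ) F d γ).1 hγ
  exact hβ' γ (hF3 d γ hγ) (h2 _ _ _ h3 hyβ)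

end LargestSize

/-! ### The case of a larger set: stationary sets and Woodin's argument. -/

section Stationary

/-- The partial function `h` has at most one value in `W` at each element of `W`. -/
def Fnl {M : Type*} [MemJ M] (W h : M) : Prop :=
  ∀ x ∈ W, ∀ y ∈ W, ∀ y' ∈ W, App h x y → App h x y' → y = y'

/-- `α` has cofinality `ω` in the order `r` of `W` and is closed under `h`. -/
def Cl {M : Type*} [MemJ M] (W r ω h α : M) : Prop :=
  (∃ c, (∀ n y y', App c n y → App c n y' → y = y') ∧
    (∀ n ∈ ω, ∃ y ∈ W, App c n y ∧ App r y α) ∧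
    ∀ x ∈ W, App r x α → ∃ n ∈ ω, ∃ y ∈ W, App c n y ∧ App r x y) ∧
  ∀ x ∈ W, App r x α → ∀ y ∈ W, App h x y → App r y α

/-- Each proper initial segment of `W` injects into `D`. -/
def SmallSegs {M : Type*} [MemJ M] (W r D : M) : Prop :=
  ∀ w ∈ W, ∃ S, (∀ x, x ∈ S ↔ x ∈ W ∧ App r x w) ∧ Inj S D

section

variable {M : Type*} [MemJ M] {b : Bool} {s t u w x : (ℕ → M) → M} [Tm b s] [Tm b t] [Tm b u]
  [Tm b w] [Tm b x]

instance : Dfn b (fun v => Fnl (s v) (t v)) :=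
  Dfn.subst₂ (by unfold Fnl; infer_instance) s t

instance : Dfn b (fun v => Cl (s v) (t v) (u v) (w v) (x v)) :=
  Dfn.subst₅ (by unfold Cl; infer_instance) s t u w x

instance : Dfn b (fun v => SmallSegs (s v) (t v) (u v)) :=
  Dfn.subst₃ (by unfold SmallSegs; infer_instance) s t u

end

variable {M : Type*} [ZFCj M]

/-- A well-order of the least size that does not inject into `D`. -/
theorem exists_successor_wo {D X : M} (hX : ¬ Inj X D) :
    ∃ W r : M, WO W r ∧ ¬ Inj W D ∧ SmallSegs W r D := by
  obtain ⟨r, hr⟩ := ZFCj.wo X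
  -- Keep the points with small segments. If `W` were small and not all of `X`, the least point
  -- outside would have its segment inside `W` and so belong to `W`.
  obtain ⟨W, hW⟩ := ZFCj.sep (fun y => ∃ S, (∀ x, x ∈ S ↔ x ∈ X ∧ App r x y) ∧ Inj S D) X
  have hsub : ∀ x ∈ W, x ∈ X := fun x hx => ((hW x).1 hx).1
  refine ⟨W, r, hr.mono hsub, fun h => ?_, fun w hw => ?_⟩
  · by_cases hXW : ∀ x ∈ X, x ∈ W
    · exact hX ((Inj.of_subset hXW).trans h)
    push Not at hXW
    obtain ⟨x, hx, hxW⟩ := hXW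
    obtain ⟨m, hm, hmW, hmin⟩ := hr.exists_min (fun x => x ∉ W) hx hxW
    obtain ⟨S, hS⟩ := ZFCj.sep (fun x => App r x m) X
    refine hmW ((hW m).2 ⟨hm, S, hS, (Inj.of_subset fun z hz => ?_).trans h⟩)
    obtain ⟨hz, hzm⟩ := (hS z).1 hz
    exact not_not.1 (hmin z hz hzm)
  · obtain ⟨S, hS, h⟩ := ((hW w).1 hw).2
    obtain ⟨S', hS'⟩ := ZFCj.sep (fun x => App r x w) W
    exact ⟨S', hS', (Inj.of_subset fun z hz =>
      (hS z).2 ⟨hsub z ((hS' z).1 hz).1, ((hS' z).1 hz).2⟩).trans h⟩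

variable {D W r ω : M}

/-- One more point does not matter: split into the open segment and `{w}`, and index the two pieces
by empty and nonempty elements of `D`. -/
theorem SmallSegs.le (hS : SmallSegs W r D) (hω : IsOmega ω) (hωD : ∀ n ∈ ω, n ∈ D)
    (hD : ∀ x ∈ D, ∀ y ∈ D, ∀ p, IsOP p x y → p ∈ D) {w : M} (hw : w ∈ W) {T : M}
    (hT : ∀ x ∈ T, x ∈ W ∧ (x = w ∨ App r x w)) : Inj T D := by
  obtain ⟨e, he, he'⟩ := hω.1.1
  obtain ⟨o, ho, hoe⟩ := hω.1.2 e he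
  have ho' : ¬ IsEmp o := fun h => h e ((hoe e).2 (.inr rfl))
  refine Inj.iUnion hD (fun i x => (IsEmp i ∧ App r x w) ∨ (¬ IsEmp i ∧ x = w)) (fun x hx => ?_)
    fun i _ B hB => ?_
  · rcases (hT x hx).2 with h | h
    · exact ⟨o, hωD o ho, .inr ⟨ho', h⟩⟩
    · exact ⟨e, hωD e he, .inl ⟨he', h⟩⟩
  · by_cases hi : IsEmp i
    · obtain ⟨S, hS, h⟩ := hS w hw
      refine (Inj.of_subset fun x hx => (hS x).2 ?_).trans h
      obtain ⟨hx, h | h⟩ := (hB x).1 hx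
      · exact ⟨(hT x hx).1, h.2⟩
      · exact absurd hi h.1
    · have : ∀ x ∈ B, x = w := fun x hx => by
        obtain ⟨-, h | h⟩ := (hB x).1 hx
        · exact absurd h.1 hi
        · exact h.2
      exact Inj.intro (fun _ y => y = e) (fun _ _ => ⟨e, hωD e he, rfl⟩)
        fun x hx x' hx' _ _ _ _ => (this x hx).trans (this x' hx').symm

/-- Regularity of the least well-order that does not inject into `D`. -/
theorem SmallSegs.exists_bound (hS : SmallSegs W r D) (hW : WO W r) (hN : ¬ Inj W D)
    (hω : IsOmega ω) (hωD : ∀ n ∈ ω, n ∈ D)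
    (hD : ∀ x ∈ D, ∀ y ∈ D, ∀ p, IsOP p x y → p ∈ D) {I : M} (hI : Inj I D) (P : M → M → Prop)
    [Dfn true (fun v => P (v 0) (v 1))]
    (hP : ∀ i ∈ I, ∀ u ∈ W, ∀ u' ∈ W, P i u → P i u' → u = u') :
    ∃ w ∈ W, ∀ i ∈ I, ∀ u ∈ W, P i u → App r u w := by
  have dP : ∀ (s t : (ℕ → M) → M) [Tm true s] [Tm true t], Dfn true (fun v => P (s v) (t v)) :=
    Dfn.subst₂ inferInstance
  by_contra! hcon
  obtain ⟨e, he, he'⟩ := hI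
  -- Without a bound, `W` is covered by the closed segments below the values of `P`, at most `D`
  -- many small sets.
  refine hN (Inj.iUnion hD (fun ξ x => ∃ i ∈ I, App e i ξ ∧ ∃ u ∈ W, P i u ∧ ¬ App r u x)
    (fun x hx => ?_) fun ξ hξ B hB => ?_)
  · obtain ⟨i, hi, u, hu, h, h'⟩ := hcon x hx
    obtain ⟨ξ, hξ, h''⟩ := he i hi
    exact ⟨ξ, hξ, i, hi, h'', u, hu, h, h'⟩
  · by_cases hne : ∃ x, x ∈ B
    · obtain ⟨x, hx⟩ := hne
      obtain ⟨-, i, hi, hiξ, u, hu, h, -⟩ := (hB x).1 hx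
      refine hS.le hω hωD hD hu fun y hy => ?_
      obtain ⟨hyW, i', hi', hiξ', u', hu', h', huy⟩ := (hB y).1 hy
      obtain rfl := he' i hi i' hi' ξ hξ hiξ hiξ'
      obtain rfl := hP i hi u hu u' hu' h h'
      refine ⟨hyW, ?_⟩
      rcases hW.tri hyW hu with h1 | h1 | h1
      · exact .inl h1
      · exact .inr h1
      · exact absurd h1 huy
    · exact Inj.of_subset fun x hx => absurd ⟨x, hx⟩ hne

/-- Starting at `η`, pass `ω` times to the least point above `x` and above all values of `h` at
points up to `x`; the supremum is closed under `h` and has cofinality `ω`. Regularity bounds each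
step and the limit. -/
theorem SmallSegs.exists_closed (hS : SmallSegs W r D) (hW : WO W r) (hN : ¬ Inj W D)
    (hω : IsOmega ω) (hωD : ∀ n ∈ ω, n ∈ D)
    (hD : ∀ x ∈ D, ∀ y ∈ D, ∀ p, IsOP p x y → p ∈ D) {h : M} (hh : Fnl W h) {η : M}
    (hη : η ∈ W) : ∃ α ∈ W, Cl W r ω h α ∧ App r η α := by
  obtain ⟨s, hs, htot, hfun, hzero, hsucc⟩ := hω.exists_iterate
    (fun x y => y ∈ W ∧ (App r x y ∧ ∀ u ∈ W, u = x ∨ App r u x → ∀ z ∈ W, App h u z → App r z y) ∧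
      ∀ y' ∈ W, App r y' y → ¬ (App r x y' ∧
        ∀ u ∈ W, u = x ∨ App r u x → ∀ z ∈ W, App h u z → App r z y'))
    (fun x => x ∈ W) (by
      rintro x y y' ⟨hy, h1, h2⟩ ⟨hy', h1', h2'⟩
      rcases hW.tri hy hy' with h3 | h3 | h3
      · exact h3
      · exact absurd h1 (h2' y hy h3)
      · exact absurd h1' (h2 y' hy' h3)) (by
      intro x hx
      obtain ⟨T, hT⟩ := ZFCj.sep (fun u => u = x ∨ App r u x) W
      have hTD : Inj T D := hS.le hω hωD hD hx fun u hu => (hT u).1 hu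
      obtain ⟨a, ha, haT⟩ := hS.exists_bound hW hN hω hωD hD hTD (fun u z => App h u z)
        fun u hu z hz z' hz' => hh u ((hT u).1 hu).1 z hz z' hz'
      obtain ⟨b, hb, hbT⟩ := hS.exists_bound hW hN hω hωD hD hTD (fun u z => u = z)
        fun u _ z _ z' _ h h' => h.symm.trans h'
      have hxb : App r x b := hbT x ((hT x).2 ⟨hx, .inl rfl⟩) x hx rfl
      have haT' : ∀ u ∈ W, u = x ∨ App r u x → ∀ z ∈ W, App h u z → App r z a :=
        fun u hu hux => haT u ((hT u).2 ⟨hu, hux⟩)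
      have hex : ∃ y ∈ W, App r x y ∧
          ∀ u ∈ W, u = x ∨ App r u x → ∀ z ∈ W, App h u z → App r z y := by
        rcases hW.tri ha hb with rfl | h1 | h1
        · exact ⟨a, ha, hxb, haT'⟩
        · exact ⟨b, hb, hxb, fun u hu hux z hz huz =>
            hW.trans hz ha hb (haT' u hu hux z hz huz) h1⟩
        · exact ⟨a, ha, hW.trans hx hb ha hxb h1, haT'⟩
      obtain ⟨y, hy, hxy⟩ := hex
      obtain ⟨y, hy, hxy, hmin⟩ := hW.exists_min (fun y => App r x y ∧
          ∀ u ∈ W, u = x ∨ App r u x → ∀ z ∈ W, App h u z → App r z y) hy hxy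
      exact ⟨y, ⟨hy, hxy, hmin⟩, hy⟩) η hη
  obtain ⟨α, hα, hαs⟩ := hS.exists_bound hW hN hω hωD hD (Inj.of_subset hωD)
    (fun n y => App s n y) fun n _ y _ y' _ => hfun n y y'
  -- Minimality makes `α` the supremum of the iterates.
  obtain ⟨α, hα, hαs, hmin⟩ := hW.exists_min (fun α => ∀ n ∈ ω, ∀ y ∈ W, App s n y → App r y α)
    hα hαs
  have hnext : ∀ x ∈ W, App r x α → ∃ n ∈ ω, ∃ y ∈ W, App s n y ∧ App r x y ∧
      ∀ z ∈ W, App h x z → App r z y := by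
    intro x hx hxα
    have h1 := hmin x hx hxα
    push Not at h1
    obtain ⟨n, hn, y, hy, hny, hyx⟩ := h1
    obtain ⟨m, hm, hmn⟩ := hω.1.2 n hn
    obtain ⟨y', hy'⟩ := htot m hm
    obtain ⟨hy'W, ⟨h2, h3⟩, -⟩ := hsucc n hn m hm hmn y y' hny hy'
    have hxy : x = y ∨ App r x y := by
      rcases hW.tri hx hy with h | h | h
      · exact .inl h
      · exact .inr h
      · exact absurd h hyx
    refine ⟨m, hm, y', hy'W, hy', ?_, h3 x hx hxy⟩
    rcases hxy with rfl | h
    · exact h2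
    · exact hW.trans hx hy hy'W h h2
  refine ⟨α, hα, ⟨⟨s, hfun, fun n hn => ?_, fun x hx hxα => ?_⟩, fun x hx hxα z hz hxz => ?_⟩, ?_⟩
  · obtain ⟨y, hy⟩ := htot n hn
    have := (hs n y hy).2
    exact ⟨y, this, hy, hαs n hn y this hy⟩
  · obtain ⟨n, hn, y, hy, h1, h2, -⟩ := hnext x hx hxα
    exact ⟨n, hn, y, hy, h1, h2⟩
  · obtain ⟨n, hn, y, hy, h1, -, h2⟩ := hnext x hx hxα
    exact hW.trans hz hy hα (h2 z hz hxz) (hαs n hn y hy h1)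
  · obtain ⟨e, he, he'⟩ := hω.1.1
    exact hαs e he η hη (hzero e he he')

/-- A partition into stationary sets, indexed by `D`. -/
theorem SmallSegs.exists_stationary_partition (hS : SmallSegs W r D) (hW : WO W r)
    (hN : ¬ Inj W D) (hω : IsOmega ω) (hωD : ∀ n ∈ ω, n ∈ D)
    (hD : ∀ x ∈ D, ∀ y ∈ D, ∀ p, IsOP p x y → p ∈ D) :
    ∃ F : M, (∀ β ∈ D, ∀ h, Fnl W h → ∃ α ∈ W, Cl W r ω h α ∧ App F α β) ∧
      (∀ α β β', App F α β → App F α β' → β = β') ∧ ∀ α β, App F α β → β ∈ D := by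
  obtain ⟨E, hE, hE1, hE2⟩ := exists_choice W (fun α e =>
    (∀ η ∈ W, App r η α → ∃ ξ ∈ D, App e η ξ) ∧
    ∀ η ∈ W, App r η α → ∀ η' ∈ W, App r η' α → ∀ ξ ∈ D, App e η ξ → App e η' ξ → η = η') (by
      intro α hα
      obtain ⟨S, hS, f, hf, hf'⟩ := hS α hα
      exact ⟨f, fun η hη h => hf η ((hS η).2 ⟨hη, h⟩), fun η hη h η' hη' h' =>
        hf' η ((hS η).2 ⟨hη, h⟩) η' ((hS η').2 ⟨hη', h'⟩)⟩)
  -- An Ulam matrix: with $e_\alpha$ injecting the segment below `α` into `D`, some `ξ` makes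
  -- $\{\alpha>\eta : e_\alpha(\eta)=\xi\}$ stationary.
  have hbig : ∀ η ∈ W, ∃ ξ ∈ D, ∀ h, Fnl W h →
      ∃ α ∈ W, Cl W r ω h α ∧ App r η α ∧ ∃ e, App E α e ∧ App e η ξ := by
    intro η hη
    by_contra! hcon
    obtain ⟨H, hH, hH1, hH2⟩ := exists_choice D (fun ξ h => Fnl W h ∧
      ∀ α ∈ W, Cl W r ω h α → App r η α → ∀ e, App E α e → ¬ App e η ξ) hcon
    have hbd : ∀ γ ∈ W, ∃ w ∈ W, ∀ ξ ∈ D, ∀ y ∈ W,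
        (∃ h, App H ξ h ∧ App h γ y) → App r y w := by
      intro γ hγ
      refine hS.exists_bound hW hN hω hωD hD (Inj.of_subset fun x hx => hx)
        (fun ξ y => ∃ h, App H ξ h ∧ App h γ y) ?_
      rintro ξ hξ y hy y' hy' ⟨h, h1, h2⟩ ⟨h', h1', h2'⟩
      obtain rfl := hH2 _ _ _ h1 h1'
      exact (hH1 ξ h h1).2.1 γ hγ y hy y' hy' h2 h2'
    -- One function `k` dominates all the counterexamples $h_\xi$, so a point closed under `k` is
    -- closed under each of them.
    obtain ⟨k, hk, hk1, hk2⟩ := exists_choice W (fun γ w => w ∈ W ∧ ∀ ξ ∈ D, ∀ y ∈ W,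
        (∃ h, App H ξ h ∧ App h γ y) → App r y w) hbd
    obtain ⟨α, hα, ⟨hcof, hcl⟩, hηα⟩ := hS.exists_closed hW hN hω hωD hD (h := k)
      (fun x _ y _ y' _ => hk2 x y y') hη
    obtain ⟨e, he⟩ := hE α hα
    obtain ⟨ξ, hξ, hξ'⟩ := (hE1 α e he).2.1 η hη hηα
    obtain ⟨h, hh⟩ := hH ξ hξ
    refine (hH1 ξ h hh).2.2 α hα ⟨hcof, fun x hx hxα y hy hxy => ?_⟩ hηα e he hξ'
    obtain ⟨w, hw⟩ := hk x hx
    obtain ⟨-, hwW, hw'⟩ := hk1 x w hw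
    exact hW.trans hy hwW hα (hw' ξ hξ y hy ⟨h, hh, hxy⟩) (hcl x hx hxα w hwW hw)
  -- Pigeonhole: one `ξ` serves more than `D` many `η`. The resulting stationary sets are disjoint
  -- because each $e_\alpha$ is injective.
  have hfiber : ∃ ξ ∈ D, ∃ B : M, (∀ η, η ∈ B ↔ η ∈ W ∧ ∀ h, Fnl W h →
      ∃ α ∈ W, Cl W r ω h α ∧ App r η α ∧ ∃ e, App E α e ∧ App e η ξ) ∧ ¬ Inj B D := by
    by_contra! hcon
    exact hN (Inj.iUnion hD (fun ξ η => ∀ h, Fnl W h →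
      ∃ α ∈ W, Cl W r ω h α ∧ App r η α ∧ ∃ e, App E α e ∧ App e η ξ) hbig hcon)
  obtain ⟨ξ, hξ, B, hB, hBD⟩ := hfiber
  obtain ⟨g, hg, hg'⟩ := (Inj.total D B).resolve_right hBD
  obtain ⟨F, hF⟩ := exists_rel W D (fun α β => ∃ η ∈ B, App g β η ∧ App r η α ∧
    ∃ e, App E α e ∧ App e η ξ)
  refine ⟨F, fun β hβ h hh => ?_, fun α β β' h h' => ?_, fun α β h => ((hF α β).1 h).2.1⟩
  · obtain ⟨η, hη, hβη⟩ := hg β hβ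
    obtain ⟨α, hα, hc, hηα, he⟩ := ((hB η).1 hη).2 h hh
    exact ⟨α, hα, hc, (hF α β).2 ⟨hα, hβ, η, hη, hβη, hηα, he⟩⟩
  · obtain ⟨hα, hβ, η, hη, hβη, hηα, e, he, heη⟩ := (hF α β).1 h
    obtain ⟨-, hβ', η', hη', hβη', hηα', e', he', heη'⟩ := (hF α β').1 h'
    obtain rfl := hE2 α e e' he he'
    obtain rfl := (hE1 α e he).2.2 η ((hB η).1 hη).1 hηα η' ((hB η').1 hη').1 hηα' ξ hξ heη heη'
    exact hg' β hβ β' hβ' η hη hβη hβη'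

/-- Woodin's argument: every set injects into a set `D` as in `exists_closed_set`. -/
theorem inj_of_closed (hω : IsOmega ω) (hωD : ∀ n ∈ ω, n ∈ D)
    (hD : ∀ x ∈ D, ∀ y ∈ D, ∀ p, IsOP p x y → p ∈ D) (hjD : ∀ x ∈ j D, x ∈ D) {β : M}
    (hβ : β ∈ j D) (hβ' : ∀ d ∈ D, j d ≠ β) (X : M) : Inj X D := by
  by_contra hX
  obtain ⟨W, r, hW, hN, hS⟩ := exists_successor_wo hX
  obtain ⟨F, hF1, hF2, hF3⟩ := hS.exists_stationary_partition hW hN hω hωD hD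
  have hjW := (elem₂ (fun W r => WO W r) W r).1 hW
  have hjS := (elem₃ (fun W r D => SmallSegs W r D) W r D).1 hS
  have hjF1 := (elem₅ (fun D W r ω F => ∀ β ∈ D, ∀ h, Fnl W h → ∃ α ∈ W, Cl W r ω h α ∧ App F α β)
    D W r ω F).1 hF1
  have hjF2 := (elem₁ (fun F => ∀ α β β', App F α β → App F α β' → β = β') F).1 hF2
  obtain ⟨G, hG, hGtot⟩ := hjW.exists_bisim hW
  have hdom : ∀ x ∈ j W, ∃ y, App G x y := by
    rcases hGtot with htot | honto
    · exact htot
    -- Otherwise `W` would inject into a proper segment of $j(W)$, hence into $j(D)\subseteq D$.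
    by_contra! ⟨x, hx, hx'⟩
    obtain ⟨S, hS, hSD⟩ := hjS x hx
    refine hN (Inj.trans (Inj.intro (fun y z => App G z y) (fun y hy => ?_) ?_)
      (hSD.trans (Inj.of_subset hjD)))
    · obtain ⟨z, hz⟩ := honto y hy
      have hzW := (hG z y hz).1
      refine ⟨z, (hS z).2 ⟨hzW, ?_⟩, hz⟩
      rcases hjW.tri hzW hx with rfl | h | h
      · exact absurd hz (hx' y)
      · exact h
      · obtain ⟨u, -, -, hu⟩ := (hG z y hz).2.2.1 x hx h
        exact absurd hu (hx' u)
    · exact fun y _ y' _ z _ h h' => hG.unique_right hjW hW hG h h'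
  have hGmono : ∀ x y x' y', App G x y → App G x' y' → App (j r) x x' → App r y y' := by
    intro x y x' y' h h' hlt
    obtain ⟨u, -, hu, hxu⟩ := (hG x' y' h').2.2.1 x (hG x y h).1 hlt
    exact hG.unique_right hjW hW hG hxu h ▸ hu
  have hjr : ∀ {x y : M}, App r x y ↔ App (j r) (j x) (j y) := fun {x y} =>
    elem₃ (fun r x y => App r x y) r x y
  -- This is $j\circ G$, an order-preserving map of $j(W)$ into itself.
  obtain ⟨h, hh⟩ := exists_rel (j W) (j W) (fun x z => ∃ y, App G x y ∧ z = j y)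
  have hhG : ∀ x y, App G x y → App h x (j y) := fun x y hxy =>
    (hh x _).2 ⟨(hG x y hxy).1, j_mem_iff.2 (hG x y hxy).2.1, y, hxy, rfl⟩
  have hhF : Fnl (j W) h := by
    intro x _ z _ z' _ h1 h2
    obtain ⟨-, -, y, hxy, rfl⟩ := (hh x z).1 h1
    obtain ⟨-, -, y', hxy', rfl⟩ := (hh x z').1 h2
    rw [hG.unique_right hjW hW hG hxy hxy']
  obtain ⟨α, hα, ⟨⟨c, hc1, hc2, hc3⟩, hcl⟩, hFα⟩ := hjF1 β hβ h hhF
  rw [hω.j_eq] at hc2 hc3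
  obtain ⟨γ, hαγ⟩ := hdom α hα
  have hγ := (hG α γ hαγ).2.1
  have hjγ : j γ ∈ j W := j_mem_iff.2 hγ
  -- An order-preserving map of a well-order into itself never decreases.
  have hincr : ∀ x y, App G x y → ¬ App (j r) (j y) x := by
    intro x y hxy hlt
    obtain ⟨m, hm, ⟨u, hmu, hlt⟩, hmin⟩ := hjW.exists_min
      (fun x => ∃ y, App G x y ∧ App (j r) (j y) x) (hG x y hxy).1 ⟨y, hxy, hlt⟩
    have huW : j u ∈ j W := j_mem_iff.2 (hG m u hmu).2.1
    obtain ⟨z, hz⟩ := hdom (j u) huW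
    exact hmin (j u) huW hlt ⟨z, hz, hjr.1 (hGmono _ _ _ _ hz hmu hlt)⟩
  have hfix : j γ = α := by
    rcases hjW.tri hjγ hα with h1 | h1 | h1
    · exact h1
    · exact absurd h1 (hincr α γ hαγ)
    · exfalso
      -- The image of `c` under `G` is an `ω`-sequence cofinal in `γ`, so $j(d)$ is cofinal in
      -- $j(\gamma)$. Its terms $j(d(n))=h(c(n))$ stay below `α` by closure, which rules out
      -- $\alpha<j(\gamma)$.
      obtain ⟨d, hd⟩ := exists_rel ω W (fun n w => ∃ y, App c n y ∧ App (j r) y α ∧ App G y w)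
      have hd1 : ∀ x ∈ W, App r x γ → ∃ n ∈ ω, ∃ w ∈ W, App d n w ∧ App r x w := by
        intro x hx hxγ
        obtain ⟨u, hu, huα, hux⟩ := (hG α γ hαγ).2.2.2 x hx hxγ
        obtain ⟨n, hn, y, hy, hny, huy⟩ := hc3 u hu huα
        obtain ⟨y', hy', hny', hyα⟩ := hc2 n hn
        obtain rfl := hc1 _ _ _ hny hny'
        obtain ⟨w, hw⟩ := hdom y hy
        have hwW := (hG y w hw).2.1
        exact ⟨n, hn, w, hwW, (hd n w).2 ⟨hn, hwW, y, hny, hyα, hw⟩, hGmono _ _ _ _ hux hw huy⟩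
      have hd2 : ∀ n w w', App d n w → App d n w' → w = w' := by
        intro n w w' h1 h2
        obtain ⟨-, -, y, hny, -, hy⟩ := (hd n w).1 h1
        obtain ⟨-, -, y', hny', -, hy'⟩ := (hd n w').1 h2
        obtain rfl := hc1 _ _ _ hny hny'
        exact hG.unique_right hjW hW hG hy hy'
      have hjd1 := (elem₅ (fun W r γ ω d => ∀ x ∈ W, App r x γ →
        ∃ n ∈ ω, ∃ w ∈ W, App d n w ∧ App r x w) W r γ ω d).1 hd1
      have hjd2 := (elem₁ (fun d => ∀ n w w', App d n w → App d n w' → w = w') d).1 hd2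
      rw [hω.j_eq] at hjd1
      obtain ⟨n, hn, w, hw, hnw, hαw⟩ := hjd1 α hα h1
      obtain ⟨y, hy, hny, hyα⟩ := hc2 n hn
      obtain ⟨v, hv⟩ := hdom y hy
      have hvW := (hG y v hv).2.1
      have hnv := (elem₃ (fun d n v => App d n v) d n v).1
        ((hd n v).2 ⟨hn, hvW, y, hny, hyα, hv⟩)
      rw [hω.j_nat n hn] at hnv
      obtain rfl := hjd2 n _ _ hnv hnw
      exact hjW.asymm hα hw hαw (hcl y hy hyα _ hw (hhG y v hv))
  subst hfix
  -- Since $j(\gamma)$ has an index under $j(F)$, `γ` has an index `δ` under `F`, and then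
  -- $\beta=j(\delta)$.
  obtain ⟨δ, hδ⟩ := (elem₂ (fun F x => ∃ δ, App F x δ) F γ).2 ⟨β, hFα⟩
  have hjδ := (elem₃ (fun F x y => App F x y) F γ δ).1 hδ
  exact hβ' δ (hF3 γ δ hδ) (hjF2 _ _ _ hjδ hFα)

variable (M) in
theorem not_cofinal : ¬ ∀ a : M, ∃ b : M, a ∈ j b := by
  obtain ⟨ω, hω⟩ := exists_isOmega (M := M)
  obtain ⟨D, hωD, hD, hjD, β, hβ, hβ'⟩ := exists_closed_set hω
  exact not_cofinal_of_largest (inj_of_closed hω hωD hD hjD hβ hβ') hβ hβ'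

end Stationary

end SetTheoryJ

theorem mainTheorem3 : SetTheoryJ.ZFCMinusJ ⊨ᵇ ∼SetTheoryJ.cofinality :=
  SetTheoryJ.models_not_cofinality fun M _ => SetTheoryJ.not_cofinal M
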